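/- Let $(G,H,\theta,B)$ be a real reductive Lie group, in the following sense: $G$ is a real Lie group with Lie algebra $\mathfrak g$, $H\subset G$ is a (maximal) compact subgroup, $\theta$ is an involutive automorphism of $\mathfrak g$ whose $+1$-eigenspace is the Lie algebra $\mathfrak h$ of $H$ and whose $-1$-eigenspace is denoted $\mathfrak m$, $B=\langle\cdot,\cdot\rangle$ is an $\mathrm{Ad}(G)$-invariant and $\theta$-invariant symmetric bilinear form on $\mathfrak g$ that is positive definite on $\mathfrak m$ and negative definite on $\mathfrak h$, and $(h,X)\mapsto h\exp X$ is a diffeomorphism from $H\times\mathfrak m$ onto $G$. Let $\Sigma=H\backslash G$ be the associated symmetric space, with base point $*=H$, the right action of $G$, and the $G$-invariant Riemannian distance given by $B$ on $\mathfrak m\cong T_*\Sigma$. Let $\partial_\infty\Sigma$ be its visual boundary, that is, the set of unit speed geodesic rays of $\Sigma$ up to bounded distance, and for $\xi,\zeta\in\partial_\infty\Sigma$ let $\angle_{\mathrm{Tits}}(\xi,\zeta)=\sup_{x\in\Sigma}\angle_x(\xi,\zeta)\in[0,\pi]$, where $\angle_x(\xi,\zeta)$ is the angle at $x$ between the geodesic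 rays issuing from $x$ in the classes $\xi$ and $\zeta$. For $s\in\mathfrak m$ write $|s|=\langle s,s\rangle^{1/2}$. If $|s|=1$, let $\eta(s)=\lim_{t\to+\infty}*e^{ts}\in\partial_\infty\Sigma$ be the class of the geodesic ray $t\mapsto *e^{ts}$, let $P_s=\{g\in G:\ e^{ts}ge^{-ts}\text{ is bounded as }t\to+\infty\}$, and for $g\in G$ let $s\cdot g=\mathrm{Ad}(h^{-1})s$, where $g=ph$ with $p\in P_s$ and $h\in H$. **Proposition.** Let $s,\sigma\in\mathfrak m$ with $|s|=|\sigma|=1$. Then $\eta(s)$ and $\eta(\sigma)$ are points of $\partial_\infty\Sigma$, the limit $$\mu_s(\sigma)=\lim_{t\to+\infty}\langle s\cdot e^{-t\sigma},\sigma\rangle$$ exists, and $$\mu_s(\sigma)=\cos\angle_{\mathrm{Tits}}(\eta(\sigma),\eta(s)).$$ In particular $\mu_\sigma(s)=\mu_s(\sigma)$. -/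

import Mathlib

open Filter Topology
open scoped Manifold ContDiff NNReal

noncomputable section

/-! ## Geodesic rays, visual boundary and Tits angle of a metric space

Only the distance function is used in these definitions. -/

namespace MetricBoundary

variable {X : Type*} [Dist X]

/-- Unit speed geodesic rays `[0, ∞) → X`. -/
def IsGeodesicRay (c : ℝ≥0 → X) : Prop :=
  ∀ t u : ℝ≥0, dist (c t) (c u) = |(t : ℝ) - (u : ℝ)|

/-- Two rays are asymptotic if they stay at bounded distance. -/
def Asymptotic (c c' : ℝ≥0 → X) : Prop :=
  ∃ C : ℝ, ∀ t : ℝ≥0, dist (c t) (c' t) ≤ C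

/-- The class of all geodesic rays asymptotic to `c`: the endpoint at infinity
`lim_{t → ∞} c t` when `c` is a geodesic ray. -/
def endpoint (c : ℝ≥0 → X) : Set (ℝ≥0 → X) :=
  {c' | IsGeodesicRay c' ∧ Asymptotic c' c}

variable (X) in
/-- The visual boundary: the set of asymptote classes of geodesic rays. -/
def visualBoundary : Set (Set (ℝ≥0 → X)) :=
  {ξ | ∃ c : ℝ≥0 → X, IsGeodesicRay c ∧ ξ = endpoint c}

/-- The Euclidean comparison angle at `x` of the triple `(x, y, z)`. -/
def comparisonAngle (x y z : X) : ℝ :=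
  Real.arccos ((dist x y ^ 2 + dist x z ^ 2 - dist y z ^ 2) / (2 * dist x y * dist x z))

/-- The (Alexandrov) angle between two geodesic rays issuing from the same point. -/
def angle (c c' : ℝ≥0 → X) : ℝ :=
  limsup (fun p : ℝ≥0 × ℝ≥0 => comparisonAngle (c 0) (c p.1) (c' p.2))
    (𝓝[>] (0 : ℝ≥0) ×ˢ 𝓝[>] (0 : ℝ≥0))

/-- The Tits angle `∠_Tits(ξ, ζ) = sup_x ∠_x(ξ, ζ)`, where `∠_x(ξ, ζ)` is the angle between the
geodesic rays issuing from `x` in the classes `ξ` and `ζ`. -/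
def titsAngle (ξ ζ : Set (ℝ≥0 → X)) : ℝ :=
  sSup {a : ℝ | ∃ c ∈ ξ, ∃ c' ∈ ζ, c 0 = c' 0 ∧ a = angle c c'}

end MetricBoundary

/-! ## Lie groups -/

section LieGroup

variable {E : Type*} [NormedAddCommGroup E] [NormedSpace ℝ E]
  {G : Type*} [TopologicalSpace G] [ChartedSpace E G] [Group G]

open Classical in
/-- The exponential map: the time one value of the integral curve, issuing from `1`, of the
left-invariant vector field generated by `X`. -/
def lieExp (X : GroupLieAlgebra 𝓘(ℝ, E) G) : G :=
  if h : ∃ γ : ℝ → G, γ 0 = 1 ∧ IsMIntegralCurve γ (mulInvariantVectorField (I := 𝓘(ℝ, E)) X)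
  then h.choose 1 else 1

/-- The adjoint representation: the differential at `1` of `x ↦ g x g⁻¹`. -/
def lieAd (g : G) : GroupLieAlgebra 𝓘(ℝ, E) G →L[ℝ] GroupLieAlgebra 𝓘(ℝ, E) G :=
  (mfderiv 𝓘(ℝ, E) 𝓘(ℝ, E) (fun x : G => g * x * g⁻¹) 1 : E →L[ℝ] E)

variable (E) in
/-- The right-trivialized velocity `c'(t) c(t)⁻¹` of a curve in `G`. -/
def rightVelocity (c : ℝ → G) (t : ℝ) : GroupLieAlgebra 𝓘(ℝ, E) G :=
  (mfderiv 𝓘(ℝ, ℝ) 𝓘(ℝ, E) (fun u : ℝ => c u * (c t)⁻¹) t : ℝ →L[ℝ] E) 1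

variable (E G) in
/-- Real reductive groups `(G, H, θ, B)`. Reductivity of the Lie algebra, orthogonality of the two
eigenspaces of `θ`, non-degeneracy of `B` and maximality of the compact subgroup `H` are
consequences of the conditions listed here. -/
structure RealReductiveGroup where
  /-- the maximal compact subgroup -/
  H : Subgroup G
  /-- the Cartan involution of the Lie algebra -/
  θ : GroupLieAlgebra 𝓘(ℝ, E) G →ₗ[ℝ] GroupLieAlgebra 𝓘(ℝ, E) G
  /-- the invariant bilinear form -/
  B : LinearMap.BilinForm ℝ (GroupLieAlgebra 𝓘(ℝ, E) G)
  isCompact_H : IsCompact (H : Set G)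
  θ_θ : ∀ X, θ (θ X) = X
  θ_bracket : ∀ X Y, θ ⁅X, Y⁆ = ⁅θ X, θ Y⁆
  B_symm : ∀ X Y, B X Y = B Y X
  B_Ad : ∀ (g : G) (X Y), B (lieAd g X) (lieAd g Y) = B X Y
  B_θ : ∀ X Y, B (θ X) (θ Y) = B X Y
  /-- the `+1`-eigenspace of `θ` is the Lie algebra of `H` -/
  θ_eq_iff : ∀ X, θ X = X ↔ ∀ t : ℝ, lieExp (t • X) ∈ H
  B_neg : ∀ X, θ X = X → X ≠ 0 → B X X < 0
  B_pos : ∀ X, θ X = -X → X ≠ 0 → 0 < B X X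
  /-- `(h, X) ↦ h * exp X` is a diffeomorphism from `H × 𝔪` onto `G`: every `g` belongs to
  `H * exp X` for exactly one `X = p g` in `𝔪`, and `p` is smooth (so that the inverse
  `g ↦ (g * (exp (p g))⁻¹, p g)` is smooth too) -/
  polar : ∃ p : G → E, ContMDiff 𝓘(ℝ, E) 𝓘(ℝ, E) ∞ p ∧
    ∀ (g : G) (X : GroupLieAlgebra 𝓘(ℝ, E) G),
      (θ X = -X ∧ g * (lieExp X)⁻¹ ∈ H) ↔ X = p g

namespace RealReductiveGroup

variable (R : RealReductiveGroup E G)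

/-- The `-1`-eigenspace `𝔪` of the Cartan involution. -/
def m : Submodule ℝ (GroupLieAlgebra 𝓘(ℝ, E) G) := LinearMap.eqLocus R.θ (-LinearMap.id)

/-- The projection of the Lie algebra onto `𝔪` along the `+1`-eigenspace of `θ`. -/
def projM (X : GroupLieAlgebra 𝓘(ℝ, E) G) : GroupLieAlgebra 𝓘(ℝ, E) G :=
  (2⁻¹ : ℝ) • (X - R.θ X)

/-- The symmetric space `Σ = H \ G`, the space of cosets `H g`. -/
def SymSpace : Type _ := Quotient (QuotientGroup.rightRel R.H)

/-- The point `* g = H g` of `H \ G`. -/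
def point (g : G) : R.SymSpace := Quotient.mk (QuotientGroup.rightRel R.H) g

/-- The length over `[0, 1]` of the curve `t ↦ H c(t)` of `H \ G`. The tangent space of `H \ G`
at `H g` is the quotient of the Lie algebra by that of `H`, moved by the right translation by `g`;
so it is identified with `𝔪`, on which the Riemannian metric is `B`, and the velocity
of `t ↦ H c(t)` is the `𝔪`-component of `c'(t) c(t)⁻¹`. -/
def curveLength (c : ℝ → G) : ℝ :=
  ∫ t in (0 : ℝ)..1,
    Real.sqrt (R.B (R.projM (rightVelocity E c t)) (R.projM (rightVelocity E c t)))

/-- The Riemannian distance of `H \ G`: the infimum of the lengths of the `C¹` curves joining two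
points; such curves are written as `t ↦ H c(t)` with `c` a `C¹` curve in `G`. -/
instance : Dist R.SymSpace where
  dist x y := sInf {l : ℝ | ∃ c : ℝ → G, ContMDiff 𝓘(ℝ, ℝ) 𝓘(ℝ, E) 1 c ∧
    R.point (c 0) = x ∧ R.point (c 1) = y ∧ l = R.curveLength c}

/-- The point `η(s) = lim_{t → ∞} * exp (t s)` of the visual boundary, for a unit vector `s`
of `𝔪`. -/
def eta (s : GroupLieAlgebra 𝓘(ℝ, E) G) : Set (ℝ≥0 → R.SymSpace) :=
  MetricBoundary.endpoint fun t : ℝ≥0 => R.point (lieExp ((t : ℝ) • s))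

/-- The parabolic subgroup `P_s`: all `g` such that `exp (t s) g exp (-t s)` is bounded, that is,
stays in a compact set, as `t → ∞`. -/
def P (s : GroupLieAlgebra 𝓘(ℝ, E) G) : Set G :=
  {g | ∃ K : Set G, IsCompact K ∧ ∀ t : ℝ, 0 ≤ t → lieExp (t • s) * g * (lieExp (t • s))⁻¹ ∈ K}

open Classical in
/-- The right action of `G` on the `H`-orbit of `s` in `𝔪`: if `g = p h` with `p` in `P_s` and
`h` in `H`, then `s · g = Ad(h⁻¹) s`. -/
def act (s : GroupLieAlgebra 𝓘(ℝ, E) G) (g : G) : GroupLieAlgebra 𝓘(ℝ, E) G :=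
  if hd : ∃ h : G, h ∈ R.H ∧ ∃ p ∈ P s, g = p * h then lieAd (hd.choose)⁻¹ s else 0

/-- The function `μ_s(σ) = lim_{t → ∞} ⟨s · exp (-t σ), σ⟩`. -/
def mu (s σ : GroupLieAlgebra 𝓘(ℝ, E) G) : ℝ :=
  limUnder atTop fun t : ℝ => R.B (R.act s (lieExp (-(t • σ)))) σ

end RealReductiveGroup

end LieGroup

end

/-!
The theorem is a statement about geodesic rays in the nonpositively curved space `H \ G`, once
the distance of `H \ G` is known to come from the polar decomposition `G = H exp 𝔪`.

*Curvature.* The polar projection `polarLog : h * exp X ↦ X` descends to a map from `H \ G` to the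
Euclidean space `𝔪`, the inverse of the Riemannian exponential map. Its differential at `exp X`
maps `Z + pr (Ad (exp X) K)` to `Z + [X, K]`, for `Z` in `𝔪` commuting with `X` and for `K` in `𝔥`
(`dLog_expG_add`); since `ad X` is symmetric for the scalar product `-B(θ ·, ·)`, it does not
increase norms (`nrm_dLog_le`). Hence `polarLog` is a contraction (`nrm_polarLog_sub_le_dist`), the
distance from `* a` to `* b` is the norm of `polarLog (b * a⁻¹)` (`dist_point`), and translating the
contraction property to the points of a geodesic gives the Bruhat–Tits inequality (`dist_sq_le`).

*Parabolic subgroups.* Write `exp (n s) g = h_n exp X_n`. As the geodesics from `*` and from `* g⁻¹`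
to `* exp (n s)` stay within the distance of their origins (`exists_approx`), for any limit point
`h` of `h_n` in the compact group `H` the element `g * h⁻¹` belongs to `P s`. So `G = P s * H`
(`exists_mem_P`), and the ray from `* exp (t σ)` in the direction `s · exp (-t σ)` belongs to
`η(s)`.

*Angles.* Let `D(t)` be the distance of `* exp (t σ)` and `* exp (t s)`. Comparison angles increase
along a pair of rays, so `1 - D(t)² / (2 t²)`, which is the cosine of such an angle, decreases to a
limit `L` (`exists_tendsto_cosComp_self`); `L` depends only on the two points at infinity, and it is
a lower bound for the cosines of their comparison angles, seen from any point (`le_cosComp`). On the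
other hand, let `a(t)` be the pairing `⟨s · exp (-t σ), σ⟩`. The contraction property at
`* exp (t σ)` shows that the comparison angles with this vertex have cosine at most `a(t)`
(`exists_endpoint_cosComp_le`), so `L ≤ a(t)`; the contraction property at `*`, applied to the
triangle `*`, `* exp (t σ)`, `* exp (u s)` with `u → ∞`, shows that `a(t) ≤ 1 - D(t)² / (2 t²)`
(`pairing_le_cosComp`). Therefore `a(t) → L`, and the Tits angle, which lies between `arccos a(t)`
and `arccos L`, is `arccos L`. The symmetry is that of `D`.
-/

noncomputable section

set_option linter.unusedSectionVars false

/-! ### Velocities of curves in a manifold -/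

section Velocity

variable {E : Type*} [NormedAddCommGroup E] [NormedSpace ℝ E]
  {F : Type*} [NormedAddCommGroup F] [NormedSpace ℝ F]
  {M : Type*} [TopologicalSpace M] [ChartedSpace E M]
  {N : Type*} [TopologicalSpace N] [ChartedSpace F N]

variable (E F) in
/-- The differential of `f` at `x`, as a map between the model spaces: all the tangent spaces of a
manifold are copies of its model space. -/
def diffAt (f : M → N) (x : M) : E →L[ℝ] F := mfderiv 𝓘(ℝ, E) 𝓘(ℝ, F) f x

/-- The function `f` is differentiable at `x` with differential `L`, the tangent spaces being
identified with the model spaces. -/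
def HasDiffAt (f : M → N) (L : E →L[ℝ] F) (x : M) : Prop :=
  HasMFDerivAt 𝓘(ℝ, E) 𝓘(ℝ, F) f x L

/-- The curve `c` has velocity `V` at time `t`, where the tangent space at `c t` is identified
with the model space `E`. -/
def HasVelocityAt (c : ℝ → M) (V : E) (t : ℝ) : Prop :=
  HasDiffAt c (ContinuousLinearMap.toSpanSingleton ℝ V) t

theorem hasDiffAt_diffAt {f : M → N} {x : M}
    (hf : MDifferentiableAt 𝓘(ℝ, E) 𝓘(ℝ, F) f x) :
    HasDiffAt f (diffAt E F f x) x := hf.hasMFDerivAt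

theorem HasVelocityAt.diffAt_apply_one {c : ℝ → M} {V : E} {t : ℝ} (h : HasVelocityAt c V t) :
    diffAt ℝ E c t 1 = V := by
  have h1 : diffAt ℝ E c t = ContinuousLinearMap.toSpanSingleton ℝ V := HasMFDerivAt.mfderiv h
  rw [h1, ContinuousLinearMap.toSpanSingleton_apply, one_smul]

theorem hasVelocityAt_diffAt {c : ℝ → M} {t : ℝ}
    (h : MDifferentiableAt 𝓘(ℝ, ℝ) 𝓘(ℝ, E) c t) : HasVelocityAt c (diffAt ℝ E c t 1) t := by
  have h1 : ContinuousLinearMap.toSpanSingleton ℝ (diffAt ℝ E c t 1) = diffAt ℝ E c t :=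
    ContinuousLinearMap.ext_ring (by simp)
  rw [HasVelocityAt, h1]
  exact hasDiffAt_diffAt h

theorem HasVelocityAt.unique {c : ℝ → M} {V W : E} {t : ℝ} (h : HasVelocityAt c V t)
    (h' : HasVelocityAt c W t) : V = W :=
  h.diffAt_apply_one.symm.trans h'.diffAt_apply_one

theorem HasVelocityAt.comp_map {f : M → N} {c : ℝ → M} {V : E} {t : ℝ}
    (h : HasVelocityAt c V t) (hf : MDifferentiableAt 𝓘(ℝ, E) 𝓘(ℝ, F) f (c t)) :
    HasVelocityAt (fun u => f (c u)) (diffAt E F f (c t) V) t := by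
  have h1 : ContinuousLinearMap.toSpanSingleton ℝ (diffAt E F f (c t) V) =
      (diffAt E F f (c t)).comp (ContinuousLinearMap.toSpanSingleton ℝ V) :=
    ContinuousLinearMap.ext_ring (by simp)
  rw [HasVelocityAt, h1]
  exact HasMFDerivAt.comp t (hasDiffAt_diffAt hf) h

theorem hasVelocityAt_iff_hasDerivAt {c : ℝ → E} {V : E} {t : ℝ} :
    HasVelocityAt c V t ↔ HasDerivAt c V t := by
  rw [hasDerivAt_iff_hasFDerivAt]
  exact hasMFDerivAt_iff_hasFDerivAt

theorem HasVelocityAt.comp_real {c : ℝ → M} {V : E} {t : ℝ} {f : ℝ → ℝ} {f' : ℝ}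
    (h : HasVelocityAt c V (f t)) (hf : HasDerivAt f f' t) :
    HasVelocityAt (fun u => c (f u)) (f' • V) t := by
  have h1 : ContinuousLinearMap.toSpanSingleton ℝ (f' • V) =
      (ContinuousLinearMap.toSpanSingleton ℝ V).comp (ContinuousLinearMap.toSpanSingleton ℝ f') :=
    ContinuousLinearMap.ext_ring (by simp)
  rw [HasVelocityAt, h1]
  exact HasMFDerivAt.comp t h hf.hasFDerivAt.hasMFDerivAt

theorem HasVelocityAt.continuousAt {c : ℝ → M} {V : E} {t : ℝ} (h : HasVelocityAt c V t) :
    ContinuousAt c t := HasMFDerivAt.continuousAt h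

theorem diffAt_comp {P : Type*} [TopologicalSpace P] [ChartedSpace F P] {g : N → P} {f : M → N}
    {x : M} (hg : MDifferentiableAt 𝓘(ℝ, F) 𝓘(ℝ, F) g (f x))
    (hf : MDifferentiableAt 𝓘(ℝ, E) 𝓘(ℝ, F) f x) (V : E) :
    diffAt E F (fun y => g (f y)) x V = diffAt F F g (f x) (diffAt E F f x V) := by
  have h : diffAt E F (g ∘ f) x = (diffAt F F g (f x)).comp (diffAt E F f x) :=
    mfderiv_comp x hg hf
  exact DFunLike.congr_fun h V

theorem diffAt_id (x : M) (V : E) : diffAt E E (fun y : M => y) x V = V := by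
  have h : diffAt E E (id : M → M) x = ContinuousLinearMap.id ℝ E := mfderiv_id
  exact DFunLike.congr_fun h V

end Velocity

/-! ### The exponential map and the adjoint representation -/

section OneParameterSubgroups

variable {E : Type*} [NormedAddCommGroup E] [NormedSpace ℝ E]
  {G : Type*} [TopologicalSpace G] [ChartedSpace E G] [Group G] [LieGroup 𝓘(ℝ, E) ∞ G]

theorem mdifferentiableAt_mul_left' (g x : G) :
    MDifferentiableAt 𝓘(ℝ, E) 𝓘(ℝ, E) (fun y => g * y) x := mdifferentiableAt_mul_left

theorem mdifferentiableAt_mul_right' (g x : G) :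
    MDifferentiableAt 𝓘(ℝ, E) 𝓘(ℝ, E) (fun y => y * g) x := mdifferentiableAt_mul_right

theorem HasVelocityAt.mul {a b : ℝ → G} {V W : E} {t : ℝ}
    (ha : HasVelocityAt a V t) (hb : HasVelocityAt b W t) :
    HasVelocityAt (fun u => a u * b u)
      (diffAt E E (fun x => x * b t) (a t) V + diffAt E E (fun x => a t * x) (b t) W) t := by
  have hm : MDifferentiableAt (𝓘(ℝ, E).prod 𝓘(ℝ, E)) 𝓘(ℝ, E) (fun q : G × G => q.1 * q.2)
      (a t, b t) := (contMDiff_mul 𝓘(ℝ, E) 1).mdifferentiableAt one_ne_zero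
  let D : E × E →L[ℝ] E :=
    mfderiv (𝓘(ℝ, E).prod 𝓘(ℝ, E)) 𝓘(ℝ, E) (fun q : G × G => q.1 * q.2) (a t, b t)
  have h2 : D (V, W) =
      diffAt E E (fun x => x * b t) (a t) V + diffAt E E (fun x => a t * x) (b t) W :=
    mfderiv_prod_eq_add_apply hm
  have h1 : ContinuousLinearMap.toSpanSingleton ℝ (D (V, W)) =
      D.comp ((ContinuousLinearMap.toSpanSingleton ℝ V).prod
        (ContinuousLinearMap.toSpanSingleton ℝ W)) :=
    ContinuousLinearMap.ext_ring (by simp)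
  have h3 : HasDiffAt (fun u => a u * b u) (D.comp ((ContinuousLinearMap.toSpanSingleton ℝ V).prod
      (ContinuousLinearMap.toSpanSingleton ℝ W))) t :=
    HasMFDerivAt.comp (I' := 𝓘(ℝ, E).prod 𝓘(ℝ, E)) (g := fun q : G × G => q.1 * q.2)
      (f := fun u => (a u, b u)) (g' := D) t hm.hasMFDerivAt (HasMFDerivAt.prodMk ha hb)
  rwa [← h2, HasVelocityAt, h1]

theorem HasVelocityAt.const_mul {b : ℝ → G} {W : E} {t : ℝ} (g : G) (hb : HasVelocityAt b W t) :
    HasVelocityAt (fun u => g * b u) (diffAt E E (fun x => g * x) (b t) W) t :=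
  hb.comp_map (mdifferentiableAt_mul_left' g _)

/-- Two curves issuing from `1`: the velocity of the product is the sum of the velocities. -/
theorem HasVelocityAt.mul_of_eq_one {a b : ℝ → G} {V W : E} {t : ℝ}
    (ha : HasVelocityAt a V t) (hb : HasVelocityAt b W t) (ha1 : a t = 1) (hb1 : b t = 1) :
    HasVelocityAt (fun u => a u * b u) (V + W) t := by
  have h := ha.mul hb
  simp only [ha1, hb1, one_mul, mul_one, diffAt_id] at h
  exact h

variable (G) in
/-- The left-invariant vector field generated by `X`, with values in the model space. -/
def leftField (X : E) (g : G) : E := diffAt E E (fun x : G => g * x) 1 X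

variable (G) in
/-- The exponential map, with the Lie algebra of `G` written as the model space. -/
def expG (X : E) : G := lieExp (E := E) (G := G) X

variable (E) in
/-- The adjoint representation, with the Lie algebra of `G` written as the model space. -/
def adG (g : G) : E →L[ℝ] E := lieAd (E := E) g

theorem diffAt_mul_left_leftField (X : E) (g x : G) :
    diffAt E E (fun y : G => g * y) x (leftField G X x) = leftField G X (g * x) := by
  have h := diffAt_comp (g := fun y : G => g * y) (f := fun y : G => x * y) (x := (1 : G))
    (mdifferentiableAt_mul_left' g _) (mdifferentiableAt_mul_left' x _) X
  simp only [mul_one] at h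
  rw [leftField, leftField, ← h]
  simp only [mul_assoc]

theorem leftField_one (X : E) : leftField G X 1 = X := by
  simp only [leftField, one_mul, diffAt_id]

theorem isMIntegralCurve_iff_hasVelocityAt {X : E} {γ : ℝ → G} :
    IsMIntegralCurve γ (mulInvariantVectorField (I := 𝓘(ℝ, E)) (G := G) X) ↔
      ∀ t, HasVelocityAt γ (leftField G X (γ t)) t := by
  simp only [HasVelocityAt, ← ContinuousLinearMap.smulRight_one_eq_toSpanSingleton]
  rfl

instance lieGroup_minSmoothness : LieGroup 𝓘(ℝ, E) (minSmoothness ℝ 3) G := by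
  simp only [minSmoothness_of_isRCLikeNormedField]; infer_instance

theorem contMDiff_one_mulInvariantVectorField (X : GroupLieAlgebra 𝓘(ℝ, E) G) :
    ContMDiff 𝓘(ℝ, E) 𝓘(ℝ, E).tangent 1
      (fun g : G => (⟨g, mulInvariantVectorField (I := 𝓘(ℝ, E)) X g⟩ : TangentBundle 𝓘(ℝ, E) G)) :=
  (contMDiff_mulInvariantVectorField (I := 𝓘(ℝ, E)) X).of_le (by
    simp only [minSmoothness_of_isRCLikeNormedField]; exact one_le_two)

/-- Left-invariant vector fields are complete. -/
theorem exists_hasVelocityAt_leftField [CompleteSpace E] [T2Space G] (X : E) :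
    ∃ γ : ℝ → G, γ 0 = 1 ∧ ∀ t, HasVelocityAt γ (leftField G X (γ t)) t := by
  obtain ⟨γ, h0, hγ⟩ := exists_isMIntegralCurveAt_of_contMDiffAt_boundaryless (t₀ := 0)
    (contMDiff_one_mulInvariantVectorField X (1 : G))
  obtain ⟨ε, hε, hγ⟩ := isMIntegralCurveAt_iff'.1 hγ
  -- left translates of a local integral curve are integral curves, so all live for the same time
  obtain ⟨δ, hδ0, hδ⟩ := exists_isMIntegralCurve_of_isMIntegralCurveOn
    (contMDiff_one_mulInvariantVectorField X) hε
    (fun x => ⟨fun t => x * γ t, by simp [h0], fun t ht => by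
      have ht' : t ∈ Metric.ball (0 : ℝ) ε := by rwa [Real.ball_eq_Ioo, zero_sub, zero_add]
      have h1 : HasDiffAt γ (ContinuousLinearMap.smulRight (1 : ℝ →L[ℝ] ℝ) (leftField G X (γ t))) t :=
        (hγ t ht').hasMFDerivAt (Metric.isOpen_ball.mem_nhds ht')
      rw [ContinuousLinearMap.smulRight_one_eq_toSpanSingleton] at h1
      have h2 := HasVelocityAt.const_mul x h1
      rw [diffAt_mul_left_leftField, HasVelocityAt,
        ← ContinuousLinearMap.smulRight_one_eq_toSpanSingleton] at h2
      exact HasMFDerivAt.hasMFDerivWithinAt h2⟩) (1 : G)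
  exact ⟨δ, hδ0, isMIntegralCurve_iff_hasVelocityAt.1 hδ⟩

variable [T2Space G]

theorem eq_of_hasVelocityAt_leftField {X : E} {γ γ' : ℝ → G} (h0 : γ 0 = γ' 0)
    (h : ∀ t, HasVelocityAt γ (leftField G X (γ t)) t)
    (h' : ∀ t, HasVelocityAt γ' (leftField G X (γ' t)) t) : γ = γ' :=
  isMIntegralCurve_Ioo_eq_of_contMDiff_boundaryless (t₀ := 0)
    (contMDiff_one_mulInvariantVectorField X) (isMIntegralCurve_iff_hasVelocityAt.2 h)
    (isMIntegralCurve_iff_hasVelocityAt.2 h') h0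

theorem expG_eq_of_hasVelocityAt {X : E} {γ : ℝ → G} (h0 : γ 0 = 1)
    (h : ∀ t, HasVelocityAt γ (leftField G X (γ t)) t) : expG G X = γ 1 := by
  have hex : ∃ γ : ℝ → G, γ 0 = 1 ∧
    IsMIntegralCurve γ (mulInvariantVectorField (I := 𝓘(ℝ, E)) (G := G) X) :=
    ⟨γ, h0, isMIntegralCurve_iff_hasVelocityAt.2 h⟩
  refine (dif_pos hex).trans ?_
  exact congrFun (eq_of_hasVelocityAt_leftField (hex.choose_spec.1.trans h0.symm)
    (isMIntegralCurve_iff_hasVelocityAt.1 hex.choose_spec.2) h) 1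

theorem expG_smul_eq_of_hasVelocityAt {X : E} {γ : ℝ → G} (h0 : γ 0 = 1)
    (h : ∀ t, HasVelocityAt γ (leftField G X (γ t)) t) (t : ℝ) : expG G (t • X) = γ t := by
  rw [expG_eq_of_hasVelocityAt (γ := fun u => γ (u * t)) (by simp [h0]), one_mul]
  intro u
  have h1 := (h (u * t)).comp_real (f := fun u => u * t) ((hasDerivAt_id u).mul_const t)
  simpa [leftField] using h1

variable [CompleteSpace E]

theorem hasVelocityAt_expG (X : E) (t : ℝ) :
    HasVelocityAt (fun u : ℝ => expG G (u • X)) (leftField G X (expG G (t • X))) t := by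
  obtain ⟨γ, h0, h⟩ := exists_hasVelocityAt_leftField (G := G) X
  have : (fun t : ℝ => expG G (t • X)) = γ :=
    funext fun t => expG_smul_eq_of_hasVelocityAt h0 h t
  rw [this, expG_smul_eq_of_hasVelocityAt h0 h]
  exact h t

@[simp] theorem expG_zero : expG G (0 : E) = 1 := by
  obtain ⟨γ, h0, h⟩ := exists_hasVelocityAt_leftField (G := G) (0 : E)
  rw [← h0, ← expG_smul_eq_of_hasVelocityAt h0 h 0, zero_smul]

theorem expG_add_smul (X : E) (a b : ℝ) :
    expG G ((a + b) • X) = expG G (a • X) * expG G (b • X) := by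
  have h2 : (fun t => expG G ((a + t) • X)) = fun t => expG G (a • X) * expG G (t • X) := by
    refine eq_of_hasVelocityAt_leftField (X := X) (by simp) (fun t => ?_) fun t => ?_
    · simpa using (hasVelocityAt_expG (G := G) X (a + t)).comp_real ((hasDerivAt_id t).const_add a)
    · have := (hasVelocityAt_expG (G := G) X t).const_mul (expG G (a • X))
      rwa [diffAt_mul_left_leftField] at this
  exact congrFun h2 b

theorem expG_neg (X : E) : expG G (-X) = (expG G X)⁻¹ := by
  have := expG_add_smul (G := G) X (-1) 1
  rw [eq_inv_iff_mul_eq_one]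
  simpa using this.symm

theorem hasVelocityAt_expG_zero (X : E) :
    HasVelocityAt (fun u : ℝ => expG G (u • X)) X 0 := by
  have := hasVelocityAt_expG (G := G) X 0
  rwa [zero_smul, expG_zero, leftField_one] at this

theorem continuous_expG_smul (X : E) : Continuous (fun u : ℝ => expG G (u • X)) :=
  continuous_iff_continuousAt.2 fun t => (hasVelocityAt_expG X t).continuousAt

/-- A one-parameter subgroup is determined by its velocity at `0`. -/
theorem eq_expG_of_hasVelocityAt_zero {X : E} {c : ℝ → G} (hc : ∀ a b, c (a + b) = c a * c b)
    (h : HasVelocityAt c X 0) (t : ℝ) : c t = expG G (t • X) := by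
  have h0 : c 0 = 1 := by simpa using hc 0 0
  refine (expG_smul_eq_of_hasVelocityAt h0 (fun u => ?_) t).symm
  have h1 : HasVelocityAt c X (u - u) := by rwa [sub_self]
  have h2 := (h1.comp_real (f := fun v => v - u) ((hasDerivAt_id u).sub_const u)).const_mul (c u)
  have h3 : (fun v => c u * c (v - u)) = c := by
    ext v; rw [← hc]; simp
  simpa [h3, h0, leftField] using h2

theorem mdifferentiableAt_conj (g x : G) :
    MDifferentiableAt 𝓘(ℝ, E) 𝓘(ℝ, E) (fun y : G => g * y * g⁻¹) x :=
  MDifferentiableAt.comp x (mdifferentiableAt_mul_right' g⁻¹ (g * x))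
    (mdifferentiableAt_mul_left' g x)

theorem adG_eq_diffAt (g : G) : adG E g = diffAt E E (fun x : G => g * x * g⁻¹) 1 := rfl

theorem hasVelocityAt_conj {c : ℝ → G} {X : E} {t : ℝ} (h : HasVelocityAt c X t) (h1 : c t = 1)
    (g : G) : HasVelocityAt (fun u => g * c u * g⁻¹) (adG E g X) t := by
  have := h.comp_map (mdifferentiableAt_conj g (c t))
  rwa [h1] at this

theorem conj_expG (g : G) (X : E) : g * expG G X * g⁻¹ = expG G (adG E g X) := by
  have := eq_expG_of_hasVelocityAt_zero (c := fun t => g * expG G (t • X) * g⁻¹)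
    (fun a b => by rw [expG_add_smul]; group)
    (hasVelocityAt_conj (hasVelocityAt_expG_zero X) (by simp) g) 1
  simpa using this

theorem adG_mul (g h : G) (X : E) : adG E (g * h) X = adG E g (adG E h X) := by
  have h1 := hasVelocityAt_conj (hasVelocityAt_expG_zero (G := G) X) (by simp) (g * h)
  have h2 := hasVelocityAt_conj (hasVelocityAt_conj (hasVelocityAt_expG_zero (G := G) X)
    (by simp) h) (by simp) g
  refine h1.unique ?_
  have h3 : (fun u : ℝ => g * h * expG G (u • X) * (g * h)⁻¹) =
    fun u => g * (h * expG G (u • X) * h⁻¹) * g⁻¹ := by ext u; group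
  rwa [h3]

@[simp] theorem adG_one (X : E) : adG E (1 : G) X = X := by
  simp [adG_eq_diffAt, diffAt_id]

@[simp] theorem adG_inv_apply (g : G) (X : E) : adG E g⁻¹ (adG E g X) = X := by
  rw [← adG_mul, inv_mul_cancel, adG_one]

@[simp] theorem adG_apply_inv (g : G) (X : E) : adG E g (adG E g⁻¹ X) = X := by
  rw [← adG_mul, mul_inv_cancel, adG_one]

end OneParameterSubgroups

/-! ### The differential of the adjoint representation -/

section AdjointDerivative

variable {E : Type*} [NormedAddCommGroup E] [NormedSpace ℝ E]
  {G : Type*} [TopologicalSpace G] [ChartedSpace E G] [Group G] [LieGroup 𝓘(ℝ, E) ∞ G]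

/-- Differentials of a family of maps with a common value at the points of interest depend
smoothly on the parameter. -/
theorem contMDiffAt_diffAt_of_const {F : Type*} [NormedAddCommGroup F] [NormedSpace ℝ F]
    {N : Type*} [TopologicalSpace N] [ChartedSpace F N] [IsManifold 𝓘(ℝ, F) 1 N]
    {m n : ℕ∞ω} {f : N → G → G} {x₀ : N} {p q : G}
    (hf : ContMDiffAt (𝓘(ℝ, F).prod 𝓘(ℝ, E)) 𝓘(ℝ, E) n (Function.uncurry f) (x₀, p))
    (hq : ∀ x, f x p = q) (hmn : m + 1 ≤ n) :
    ContMDiffAt 𝓘(ℝ, F) 𝓘(ℝ, E →L[ℝ] E) m (fun x => diffAt E E (f x) p) x₀ := by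
  have h := ContMDiffAt.mfderiv f (fun _ => p) hf contMDiffAt_const hmn
  have h1 : inTangentCoordinates 𝓘(ℝ, E) 𝓘(ℝ, E) (fun _ : N => p) (fun x => f x p)
      (fun x => diffAt E E (f x) p) x₀ = fun x => diffAt E E (f x) p := by
    ext x v
    rw [inTangentCoordinates_eq (fun _ : N => p) (fun x => f x p) _ (mem_chart_source E p)
      (by rw [hq, hq]; exact mem_chart_source E q)]
    have e1 : (tangentBundleCore 𝓘(ℝ, E) G).coordChange (achart E p) (achart E p) p v = v :=
      (tangentBundleCore 𝓘(ℝ, E) G).coordChange_self _ _ (mem_chart_source E p) v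
    have e2 (w : E) :
        (tangentBundleCore 𝓘(ℝ, E) G).coordChange (achart E q) (achart E q) q w = w :=
      (tangentBundleCore 𝓘(ℝ, E) G).coordChange_self _ _ (mem_chart_source E q) w
    simp only [ContinuousLinearMap.comp_apply, e1, hq, e2]
  rw [← h1]
  exact h

/-- Velocities of a family of curves, at points with a common value, depend smoothly on the
parameter. -/
theorem contMDiffAt_diffAt_curve {m n : ℕ∞ω} {f : ℝ → ℝ → G} {t₀ : ℝ}
    {q : G}
    (hf : ContMDiffAt (𝓘(ℝ, ℝ).prod 𝓘(ℝ, ℝ)) 𝓘(ℝ, E) n (Function.uncurry f) (t₀, t₀))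
    (hq : ∀ x, f x x = q) (hmn : m + 1 ≤ n) :
    ContMDiffAt 𝓘(ℝ, ℝ) 𝓘(ℝ, ℝ →L[ℝ] E) m (fun x => diffAt ℝ E (f x) x) t₀ := by
  have h := ContMDiffAt.mfderiv f (fun x => x) hf contMDiffAt_id hmn
  have h1 : inTangentCoordinates 𝓘(ℝ, ℝ) 𝓘(ℝ, E) (fun x : ℝ => x) (fun x => f x x)
      (fun x => diffAt ℝ E (f x) x) t₀ = fun x => diffAt ℝ E (f x) x := by
    ext x
    rw [inTangentCoordinates_eq (fun x : ℝ => x) (fun x => f x x) _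
      (show x ∈ (chartAt ℝ t₀).source by rw [chartAt_self_eq]; exact Set.mem_univ x)
      (by rw [hq, hq]; exact mem_chart_source E q)]
    have e2 (w : E) :
        (tangentBundleCore 𝓘(ℝ, E) G).coordChange (achart E q) (achart E q) q w = w :=
      (tangentBundleCore 𝓘(ℝ, E) G).coordChange_self _ _ (mem_chart_source E q) w
    simp only [ContinuousLinearMap.comp_apply, hq, tangentBundleCore_coordChange_model_space]
    exact e2 _
  rw [← h1]
  exact h

theorem contMDiffAt_adG (g₀ : G) :
    ContMDiffAt 𝓘(ℝ, E) 𝓘(ℝ, E →L[ℝ] E) ∞ (fun g : G => adG E g) g₀ := by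
  refine contMDiffAt_diffAt_of_const (f := fun g x : G => g * x * g⁻¹) (n := ∞) (p := 1) (q := 1)
    ?_ (by simp) (by simp)
  have h1 : ContMDiff (𝓘(ℝ, E).prod 𝓘(ℝ, E)) 𝓘(ℝ, E) ∞ (fun q : G × G => q.1 * q.2 * q.1⁻¹) :=
    (contMDiff_fst.mul contMDiff_snd).mul contMDiff_fst.inv
  exact h1.contMDiffAt

variable (E G) in
/-- The chart of `G` at the neutral element. -/
def chartOne : PartialEquiv G E := extChartAt 𝓘(ℝ, E) (1 : G)

variable (E G) in
/-- The multiplication of `G` in the chart at the neutral element. -/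
def chartMul (q : E × E) : E :=
  chartOne E G ((chartOne E G).symm q.1 * (chartOne E G).symm q.2)

theorem chartOne_symm_chartOne_one : (chartOne E G).symm (chartOne E G 1) = 1 :=
  extChartAt_to_inv (I := 𝓘(ℝ, E)) (1 : G)

theorem contMDiffAt_chartOne_symm :
    ContMDiffAt 𝓘(ℝ, E) 𝓘(ℝ, E) ∞ (chartOne E G).symm (chartOne E G 1) :=
  (contMDiffOn_extChartAt_symm (1 : G)).contMDiffAt (extChartAt_target_mem_nhds (1 : G))

theorem contDiffAt_chartMul :
    ContDiffAt ℝ ∞ (chartMul E G) (chartOne E G 1, chartOne E G 1) := by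
  rw [← contMDiffAt_iff_contDiffAt]
  have h1 : ContMDiffAt 𝓘(ℝ, E × E) 𝓘(ℝ, E) ∞
      (fun q : E × E => (chartOne E G).symm q.1 * (chartOne E G).symm q.2)
      (chartOne E G 1, chartOne E G 1) :=
    (ContMDiffAt.comp (chartOne E G 1, chartOne E G 1) (g := (chartOne E G).symm)
      contMDiffAt_chartOne_symm contDiffAt_fst.contMDiffAt).mul
      (ContMDiffAt.comp (chartOne E G 1, chartOne E G 1) (g := (chartOne E G).symm)
      contMDiffAt_chartOne_symm contDiffAt_snd.contMDiffAt)
  refine ContMDiffAt.comp (chartOne E G 1, chartOne E G 1) (g := chartOne E G) ?_ h1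
  simp only [chartOne_symm_chartOne_one, mul_one]
  exact contMDiffAt_extChartAt

theorem diffAt_one_eq_fderiv {f : G → E} (hf : MDifferentiableAt 𝓘(ℝ, E) 𝓘(ℝ, E) f 1) :
    diffAt E E f 1 = fderiv ℝ (fun y => f ((chartOne E G).symm y)) (chartOne E G 1) := by
  have h := hf.mfderiv
  simp only [modelWithCornersSelf_coe, Set.range_id, fderivWithin_univ] at h
  exact h

theorem diffAt_chartOne_one (V : E) : diffAt E E (chartOne E G) 1 V = V := by
  rw [diffAt_one_eq_fderiv (f := chartOne E G)
    (mdifferentiableAt_extChartAt (mem_chart_source E (1 : G)))]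
  have h : (fun y => chartOne E G ((chartOne E G).symm y)) =ᶠ[𝓝 (chartOne E G 1)] id := by
    filter_upwards [extChartAt_target_mem_nhds (I := 𝓘(ℝ, E)) (1 : G)] with y hy
    exact (chartOne E G).right_inv hy
  rw [h.fderiv_eq, fderiv_id]
  rfl

/-- Near the neutral element, the differentials of left and right translations are given in the
chart by the partial differentials of the multiplication. -/
theorem eventually_diffAt_chartOne : ∀ᶠ y in 𝓝 (chartOne E G 1), ∀ V : E,
    diffAt E E (chartOne E G) ((chartOne E G).symm y) (leftField G V ((chartOne E G).symm y)) =
      fderiv ℝ (chartMul E G) (y, chartOne E G 1) (0, V) ∧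
    diffAt E E (chartOne E G) ((chartOne E G).symm y)
      (diffAt E E (fun x => x * (chartOne E G).symm y) 1 V) =
      fderiv ℝ (chartMul E G) (chartOne E G 1, y) (V, 0) := by
  have h1 : ∀ᶠ q in 𝓝 (chartOne E G 1, chartOne E G 1),
      DifferentiableAt ℝ (chartMul E G) q := by
    have := (contDiffAt_chartMul (E := E) (G := G)).of_le (m := 1) (by simp)
    exact (this.eventually (by simp)).mono fun q hq => hq.differentiableAt one_ne_zero
  have hl := ((Continuous.prodMk_left (chartOne E G 1)).continuousAt
    (x := chartOne E G 1)).eventually h1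
  have hr := ((Continuous.prodMk_right (chartOne E G 1)).continuousAt
    (x := chartOne E G 1)).eventually h1
  filter_upwards [hl, hr, extChartAt_target_mem_nhds (I := 𝓘(ℝ, E)) (1 : G)] with y hyl hyr hy V
  set e := chartOne E G 1
  set g : G := (chartOne E G).symm y with hg
  have hgs : g ∈ (chartAt E (1 : G)).source := by
    have := (extChartAt 𝓘(ℝ, E) (1 : G)).map_target hy
    rwa [extChartAt_source] at this
  have hφ : MDifferentiableAt 𝓘(ℝ, E) 𝓘(ℝ, E) (chartOne E G) g :=
    mdifferentiableAt_extChartAt hgs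
  have hφl : MDifferentiableAt 𝓘(ℝ, E) 𝓘(ℝ, E) (chartOne E G) (g * 1) := by rwa [mul_one]
  have hφr : MDifferentiableAt 𝓘(ℝ, E) 𝓘(ℝ, E) (chartOne E G) (1 * g) := by rwa [one_mul]
  constructor
  · have h2 := diffAt_comp (g := chartOne E G) (f := fun x => g * x) hφl
      (mdifferentiableAt_mul_left' g 1) V
    rw [diffAt_one_eq_fderiv (f := fun x => chartOne E G (g * x))
      (MDifferentiableAt.comp (1 : G) hφl (mdifferentiableAt_mul_left' g 1))] at h2
    simp only [mul_one] at h2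
    rw [leftField, ← h2]
    have h3 := hyl.hasFDerivAt.comp (f := fun z : E => (y, z)) e
      ((hasFDerivAt_const y e).prodMk (hasFDerivAt_id e))
    have h4 : fderiv ℝ (fun z => chartOne E G (g * (chartOne E G).symm z)) e = _ := h3.fderiv
    rw [h4]
    simp
  · have h2 := diffAt_comp (g := chartOne E G) (f := fun x => x * g) hφr
      (mdifferentiableAt_mul_right' g 1) V
    rw [diffAt_one_eq_fderiv (f := fun x => chartOne E G (x * g))
      (MDifferentiableAt.comp (1 : G) hφr (mdifferentiableAt_mul_right' g 1))] at h2
    simp only [one_mul] at h2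
    rw [← h2]
    have h3 := hyr.hasFDerivAt.comp (f := fun z : E => (z, y)) e
      ((hasFDerivAt_id e).prodMk (hasFDerivAt_const y e))
    have h4 : fderiv ℝ (fun z => chartOne E G ((chartOne E G).symm z * g)) e = _ := h3.fderiv
    rw [h4]
    simp

variable (G) in
/-- The Lie bracket, with the Lie algebra of `G` written as the model space. -/
def bracketG (X Y : E) : E :=
  (Bracket.bracket : GroupLieAlgebra 𝓘(ℝ, E) G → GroupLieAlgebra 𝓘(ℝ, E) G →
    GroupLieAlgebra 𝓘(ℝ, E) G) X Y

theorem fderiv_chartMul_left (V : E) :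
    fderiv ℝ (chartMul E G) (chartOne E G 1, chartOne E G 1) (0, V) = V := by
  have h := ((eventually_diffAt_chartOne (E := E) (G := G)).self_of_nhds V).1
  rwa [chartOne_symm_chartOne_one, leftField_one, diffAt_chartOne_one, eq_comm] at h

theorem fderiv_chartMul_right (V : E) :
    fderiv ℝ (chartMul E G) (chartOne E G 1, chartOne E G 1) (V, 0) = V := by
  have h := ((eventually_diffAt_chartOne (E := E) (G := G)).self_of_nhds V).2
  rw [chartOne_symm_chartOne_one] at h
  simpa only [mul_one, diffAt_id, diffAt_chartOne_one, eq_comm] using h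

theorem differentiableAt_fderiv_chartMul :
    DifferentiableAt ℝ (fderiv ℝ (chartMul E G)) (chartOne E G 1, chartOne E G 1) :=
  ((contDiffAt_chartMul (E := E) (G := G)).fderiv_right (m := 1) (by
    rw [one_add_one_eq_two]; exact ENat.LEInfty.out)).differentiableAt one_ne_zero

/-- In the chart at the neutral element, the bracket is the antisymmetrized second mixed derivative
of the multiplication. -/
theorem bracketG_eq (X Y : E) :
    bracketG G X Y =
      fderiv ℝ (fderiv ℝ (chartMul E G)) (chartOne E G 1, chartOne E G 1) (X, 0) (0, Y) -
      fderiv ℝ (fderiv ℝ (chartMul E G)) (chartOne E G 1, chartOne E G 1) (Y, 0) (0, X) := by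
  set e := chartOne E G 1 with he
  have hv (V : E) : (fun y => (VectorField.mpullbackWithin 𝓘(ℝ, E) 𝓘(ℝ, E)
      (extChartAt 𝓘(ℝ, E) (1 : G)).symm
      (mulInvariantVectorField (I := 𝓘(ℝ, E)) (G := G) V) (Set.range 𝓘(ℝ, E)) y : E)) =ᶠ[𝓝 e]
      fun y => fderiv ℝ (chartMul E G) (y, e) (0, V) := by
    filter_upwards [eventually_diffAt_chartOne (E := E) (G := G),
      extChartAt_target_mem_nhds (I := 𝓘(ℝ, E)) (1 : G)] with y hy hyt
    rw [← (hy V).1, VectorField.mpullbackWithin_apply,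
      ContinuousLinearMap.inverse_eq
        (mfderivWithin_extChartAt_symm_comp_mfderiv_extChartAt hyt)
        (mfderiv_extChartAt_comp_mfderivWithin_extChartAt_symm hyt)]
    rfl
  have hd (V W : E) : fderiv ℝ (fun y => fderiv ℝ (chartMul E G) (y, e) (0, V)) e W =
      fderiv ℝ (fderiv ℝ (chartMul E G)) (e, e) (W, 0) (0, V) := by
    have h1 := (differentiableAt_fderiv_chartMul (E := E) (G := G)).hasFDerivAt.comp
      (f := fun y : E => (y, e)) e ((hasFDerivAt_id e).prodMk (hasFDerivAt_const e e))
    have h2 := h1.clm_apply (hasFDerivAt_const ((0, V) : E × E) e)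
    have h3 : fderiv ℝ (fun y => fderiv ℝ (chartMul E G) (y, e) (0, V)) e = _ := h2.fderiv
    rw [h3]
    simp
    rfl
  have hid : (diffAt E E (chartOne E G) (1 : G)).inverse = ContinuousLinearMap.id ℝ E := by
    have h1 : diffAt E E (chartOne E G) (1 : G) = ContinuousLinearMap.id ℝ E := by
      ext V; exact diffAt_chartOne_one (G := G) V
    rw [h1, ContinuousLinearMap.inverse_id]
  have hb : bracketG G X Y = VectorField.lieBracket ℝ
      (fun y => fderiv ℝ (chartMul E G) (y, e) (0, X))
      (fun y => fderiv ℝ (chartMul E G) (y, e) (0, Y)) e := by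
    refine Eq.trans ?_ (Filter.EventuallyEq.lieBracket_vectorField_eq (hv X) (hv Y))
    refine Eq.trans ?_ (congrFun VectorField.lieBracketWithin_univ e)
    have := VectorField.mlieBracketWithin_apply (I := 𝓘(ℝ, E)) (s := Set.univ) (x₀ := (1 : G))
      (V := mulInvariantVectorField (I := 𝓘(ℝ, E)) (G := G) X)
      (W := mulInvariantVectorField (I := 𝓘(ℝ, E)) (G := G) Y)
    refine Eq.trans this ?_
    refine (DFunLike.congr_fun hid _).trans ?_
    simp only [modelWithCornersSelf_coe, Set.range_id, Set.preimage_univ, Set.inter_self]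
    rfl
  rw [hb, VectorField.lieBracket, hd, hd, fderiv_chartMul_left, fderiv_chartMul_left]

variable [CompleteSpace E] [T2Space G]

/-- The left-invariant field generated by `Y` is, at `g`, the right translate of `Ad (g) Y`. -/
theorem diffAt_mul_right_adG (g : G) (Y : E) :
    diffAt E E (fun x => x * g) 1 (adG E g Y) = leftField G Y g := by
  have h1 : MDifferentiableAt 𝓘(ℝ, E) 𝓘(ℝ, E) (fun x : G => x * g) (g * 1 * g⁻¹) :=
    mdifferentiableAt_mul_right' g _
  have h := diffAt_comp (g := fun x : G => x * g) (f := fun x : G => g * x * g⁻¹) h1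
    (mdifferentiableAt_conj g 1) Y
  simp only [inv_mul_cancel_right, mul_one, mul_inv_cancel] at h
  rw [leftField, h, adG_eq_diffAt]

/-- The differential of the adjoint representation is the bracket. -/
theorem hasDerivAt_adG_zero (X Y : E) :
    HasDerivAt (fun t : ℝ => adG E (expG G (t • X)) Y) (bracketG G X Y) 0 := by
  set e := chartOne E G 1 with he
  set D := fderiv ℝ (fderiv ℝ (chartMul E G)) (e, e) with hD
  -- the curve in the chart
  have hy : HasDerivAt (fun t : ℝ => chartOne E G (expG G (t • X))) X 0 := by
    have h1 : MDifferentiableAt 𝓘(ℝ, E) 𝓘(ℝ, E) (chartOne E G) 1 :=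
      mdifferentiableAt_extChartAt (mem_chart_source E (1 : G))
    have h2 := (hasVelocityAt_expG_zero (G := G) X).comp_map (f := chartOne E G) (by simpa using h1)
    rw [zero_smul, expG_zero, diffAt_chartOne_one] at h2
    exact hasVelocityAt_iff_hasDerivAt.1 h2
  have hy0 : chartOne E G (expG G ((0 : ℝ) • X)) = e := by simp [he]
  obtain ⟨α', hα⟩ : ∃ α', HasDerivAt (fun t : ℝ => adG E (expG G (t • X)) Y) α' 0 := by
    have h1 := (hasVelocityAt_expG_zero (G := G) X).comp_map
      ((contMDiffAt_adG (E := E) (expG G ((0 : ℝ) • X))).mdifferentiableAt (by simp))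
    exact ⟨_, (hasVelocityAt_iff_hasDerivAt.1 h1).clm_apply (hasDerivAt_const (0 : ℝ) Y)⟩
  have hDf : HasFDerivAt (fderiv ℝ (chartMul E G)) D (e, e) :=
    differentiableAt_fderiv_chartMul.hasFDerivAt
  -- differentiate `(g x g⁻¹) g = g x` along the curve
  have hid : (fun t : ℝ => fderiv ℝ (chartMul E G) (e, chartOne E G (expG G (t • X)))
      (adG E (expG G (t • X)) Y, 0)) =ᶠ[𝓝 0]
      fun t => fderiv ℝ (chartMul E G) (chartOne E G (expG G (t • X)), e) (0, Y) := by
    have h1 : Tendsto (fun t : ℝ => chartOne E G (expG G (t • X))) (𝓝 0) (𝓝 e) := by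
      have := hy.continuousAt.tendsto
      rwa [hy0] at this
    have h2 : ∀ᶠ t : ℝ in 𝓝 0, expG G (t • X) ∈ (chartOne E G).source := by
      have h3 := (continuous_expG_smul (G := G) X).continuousAt (x := 0)
      refine h3.eventually ?_
      simp only [zero_smul, expG_zero]
      exact extChartAt_source_mem_nhds (I := 𝓘(ℝ, E)) (1 : G)
    filter_upwards [h1.eventually (eventually_diffAt_chartOne (E := E) (G := G)), h2] with t ht hs
    have h3 := (ht Y).1
    have h4 := (ht (adG E (expG G (t • X)) Y)).2
    rw [(chartOne E G).left_inv hs] at h3 h4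
    rw [← h3, ← h4, diffAt_mul_right_adG]
  have hDf0 : HasFDerivAt (fderiv ℝ (chartMul E G)) D (e, chartOne E G (expG G ((0 : ℝ) • X))) := by
    rwa [hy0]
  have hDf0' : HasFDerivAt (fderiv ℝ (chartMul E G)) D
      (chartOne E G (expG G ((0 : ℝ) • X)), e) := by rwa [hy0]
  have hl : HasDerivAt (fun t : ℝ => fderiv ℝ (chartMul E G) (e, chartOne E G (expG G (t • X))))
      (D (0, X)) 0 :=
    hDf0.comp_hasDerivAt (f := fun t : ℝ => (e, chartOne E G (expG G (t • X)))) (0 : ℝ)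
      ((hasDerivAt_const (0 : ℝ) e).prodMk hy)
  have hr : HasDerivAt (fun t : ℝ => fderiv ℝ (chartMul E G) (chartOne E G (expG G (t • X)), e))
      (D (X, 0)) 0 :=
    hDf0'.comp_hasDerivAt (f := fun t : ℝ => (chartOne E G (expG G (t • X)), e)) (0 : ℝ)
      (hy.prodMk (hasDerivAt_const (0 : ℝ) e))
  have hl' := hl.clm_apply (hα.prodMk (hasDerivAt_const (0 : ℝ) (0 : E)))
  have hr' := hr.clm_apply (hasDerivAt_const (0 : ℝ) ((0, Y) : E × E))
  have key := (hl'.congr_of_eventuallyEq hid.symm).unique hr'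
  rw [hy0, zero_smul, expG_zero, adG_one, fderiv_chartMul_right, map_zero, add_zero] at key
  have hsymm : D (0, X) (Y, 0) = D (Y, 0) (0, X) :=
    ((contDiffAt_chartMul (E := E) (G := G)).isSymmSndFDerivAt (by
      rw [minSmoothness_of_isRCLikeNormedField]; exact ENat.LEInfty.out)) _ _
  rw [bracketG_eq, ← hD, ← key, ← hsymm]
  simpa using hα

end AdjointDerivative

/-! ### The Cartan involution and the associated scalar product -/

namespace RealReductiveGroup

section Algebra

variable {E : Type*} [NormedAddCommGroup E] [NormedSpace ℝ E]
  {G : Type*} [TopologicalSpace G] [ChartedSpace E G] [Group G]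
  (R : RealReductiveGroup E G)

/-- The Cartan involution, with the Lie algebra of `G` written as the model space. -/
def th : E →ₗ[ℝ] E := R.θ

/-- The invariant form, with the Lie algebra of `G` written as the model space. -/
def bil : LinearMap.BilinForm ℝ E := R.B

/-- The scalar product `(X, Y) ↦ -B(θ X, Y)`, which is positive definite and equal to `B`
on `𝔪`. -/
def ip : LinearMap.BilinForm ℝ E := -(R.bil.comp R.th LinearMap.id)

/-- The norm of the scalar product `-B(θ X, Y)`. -/
def nrm (X : E) : ℝ := Real.sqrt (R.ip X X)

/-- The projection onto `𝔪`, with the Lie algebra of `G` written as the model space. -/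
def pr : E →ₗ[ℝ] E := (2⁻¹ : ℝ) • (LinearMap.id - R.th)

@[simp] theorem th_th (X : E) : R.th (R.th X) = X := R.θ_θ X

theorem bil_symm (X Y : E) : R.bil X Y = R.bil Y X := R.B_symm X Y

theorem bil_th (X Y : E) : R.bil (R.th X) (R.th Y) = R.bil X Y := R.B_θ X Y

theorem bil_adG (g : G) (X Y : E) : R.bil (adG E g X) (adG E g Y) = R.bil X Y := R.B_Ad g X Y

theorem ip_apply (X Y : E) : R.ip X Y = -R.bil (R.th X) Y := rfl

theorem pr_apply (X : E) : R.pr X = (2⁻¹ : ℝ) • (X - R.th X) := rfl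

theorem th_pr (X : E) : R.th (R.pr X) = -R.pr X := by
  simp only [pr_apply, map_smul, map_sub, th_th, ← smul_neg, neg_sub]

theorem th_sub_pr (X : E) : R.th (X - R.pr X) = X - R.pr X := by
  rw [map_sub, th_pr, pr_apply, smul_sub]
  module

theorem pr_eq_self {X : E} (hX : R.th X = -X) : R.pr X = X := by
  rw [pr_apply, hX]; module

theorem pr_eq_zero {X : E} (hX : R.th X = X) : R.pr X = 0 := by
  rw [pr_apply, hX, sub_self, smul_zero]

theorem ip_symm (X Y : E) : R.ip X Y = R.ip Y X := by
  rw [ip_apply, ip_apply, ← R.bil_th (R.th X) Y, th_th, bil_symm]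

theorem ip_th (X Y : E) : R.ip (R.th X) (R.th Y) = R.ip X Y := by
  rw [ip_apply, ip_apply, bil_th]

theorem ip_eq_bil {X : E} (hX : R.th X = -X) (Y : E) : R.ip X Y = R.bil X Y := by
  rw [ip_apply, hX]; simp

/-- The two eigenspaces of the Cartan involution are orthogonal. -/
theorem ip_eq_zero {X Y : E} (hX : R.th X = X) (hY : R.th Y = -Y) : R.ip X Y = 0 := by
  have h := R.ip_th X Y
  rw [hX, hY, map_neg] at h
  linarith

theorem ip_eq_zero' {X Y : E} (hX : R.th X = -X) (hY : R.th Y = Y) : R.ip X Y = 0 := by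
  rw [ip_symm, R.ip_eq_zero hY hX]

theorem ip_self_nonneg (X : E) : 0 ≤ R.ip X X := by
  have hH : ∀ K : E, R.th K = K → 0 ≤ R.ip K K := fun K hK => by
    rw [ip_apply, hK, neg_nonneg]
    by_cases h : K = 0
    · simp [h]
    · exact (R.B_neg K hK h).le
  have hM : ∀ K : E, R.th K = -K → 0 ≤ R.ip K K := fun K hK => by
    rw [R.ip_eq_bil hK]
    by_cases h : K = 0
    · simp [h]
    · exact (R.B_pos K hK h).le
  have h1 := hH _ (R.th_sub_pr X)
  have h2 := hM _ (R.th_pr X)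
  have h3 := R.ip_eq_zero (R.th_sub_pr X) (R.th_pr X)
  have h4 := R.ip_eq_zero' (R.th_pr X) (R.th_sub_pr X)
  have : R.ip X X = R.ip ((X - R.pr X) + R.pr X) ((X - R.pr X) + R.pr X) := by
    rw [sub_add_cancel]
  rw [this]
  simp only [map_add, LinearMap.add_apply, h3, h4]
  linarith

theorem eq_zero_of_ip_self_eq_zero {X : E} (h : R.ip X X = 0) : X = 0 := by
  have h1 := R.ip_self_nonneg (X - R.pr X)
  have h2 := R.ip_self_nonneg (R.pr X)
  have h3 := R.ip_eq_zero (R.th_sub_pr X) (R.th_pr X)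
  have h4 := R.ip_eq_zero' (R.th_pr X) (R.th_sub_pr X)
  have h5 : R.ip X X = R.ip ((X - R.pr X) + R.pr X) ((X - R.pr X) + R.pr X) := by
    rw [sub_add_cancel]
  rw [h] at h5
  simp only [map_add R.ip, map_add (R.ip _), LinearMap.add_apply, h3, h4] at h5
  have h6 : R.pr X = 0 := by
    by_contra h0
    have := R.B_pos (R.pr X) (R.th_pr X) h0
    rw [R.ip_eq_bil (R.th_pr X)] at h2 h5
    change 0 < R.bil (R.pr X) (R.pr X) at this
    linarith
  have h7 : X - R.pr X = 0 := by
    by_contra h0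
    have := R.B_neg (X - R.pr X) (R.th_sub_pr X) h0
    change R.bil (X - R.pr X) (X - R.pr X) < 0 at this
    have h8 := R.ip_apply (X - R.pr X) (X - R.pr X)
    rw [R.th_sub_pr] at h8
    linarith
  rwa [h6, sub_zero] at h7

theorem nrm_nonneg (X : E) : 0 ≤ R.nrm X := Real.sqrt_nonneg _

theorem nrm_sq (X : E) : R.nrm X ^ 2 = R.ip X X := Real.sq_sqrt (R.ip_self_nonneg X)

@[simp] theorem nrm_zero : R.nrm (0 : E) = 0 := by simp [nrm]

theorem nrm_neg (X : E) : R.nrm (-X) = R.nrm X := by simp [nrm]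

theorem nrm_smul (a : ℝ) (X : E) : R.nrm (a • X) = |a| * R.nrm X := by
  have : R.ip (a • X) (a • X) = a ^ 2 * R.ip X X := by
    simp only [map_smul, LinearMap.smul_apply, smul_eq_mul]; ring
  rw [nrm, nrm, this, Real.sqrt_mul (sq_nonneg a), Real.sqrt_sq_eq_abs]

theorem eq_zero_of_nrm_eq_zero {X : E} (h : R.nrm X = 0) : X = 0 :=
  R.eq_zero_of_ip_self_eq_zero (by rw [← R.nrm_sq, h]; simp)

theorem abs_ip_le (X Y : E) : |R.ip X Y| ≤ R.nrm X * R.nrm Y := by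
  have h := LinearMap.BilinForm.apply_sq_le_of_symm R.ip R.ip_self_nonneg
    ⟨fun X Y => R.ip_symm X Y⟩ X Y
  rw [← R.nrm_sq, ← R.nrm_sq, ← mul_pow] at h
  exact abs_le_of_sq_le_sq h (mul_nonneg (R.nrm_nonneg X) (R.nrm_nonneg Y))

theorem ip_le (X Y : E) : R.ip X Y ≤ R.nrm X * R.nrm Y := (le_abs_self _).trans (R.abs_ip_le X Y)

theorem nrm_sub_sq (X Y : E) :
    R.nrm (X - Y) ^ 2 = R.nrm X ^ 2 + R.nrm Y ^ 2 - 2 * R.ip X Y := by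
  simp only [nrm_sq, map_sub, LinearMap.sub_apply, R.ip_symm Y X]; ring

theorem nrm_add_sq (X Y : E) :
    R.nrm (X + Y) ^ 2 = R.nrm X ^ 2 + R.nrm Y ^ 2 + 2 * R.ip X Y := by
  simp only [nrm_sq, map_add, LinearMap.add_apply, R.ip_symm Y X]; ring

theorem nrm_add_le (X Y : E) : R.nrm (X + Y) ≤ R.nrm X + R.nrm Y := by
  refine abs_le_of_sq_le_sq' ?_ (add_nonneg (R.nrm_nonneg X) (R.nrm_nonneg Y)) |>.2
  rw [nrm_add_sq]
  have := R.ip_le X Y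
  nlinarith

theorem nrm_sub_rev (X Y : E) : R.nrm (X - Y) = R.nrm (Y - X) := by
  rw [← nrm_neg, neg_sub]

theorem nrm_le_of_sq_le_ip {X Y : E} (h : R.ip X X ≤ R.ip Y X) : R.nrm X ≤ R.nrm Y := by
  rw [← nrm_sq] at h
  have h1 := R.ip_le Y X
  by_contra! h2
  nlinarith [R.nrm_nonneg X, R.nrm_nonneg Y]

theorem continuous_ip_self [FiniteDimensional ℝ E] : Continuous fun X : E => R.ip X X := by
  let b := R.ip.toContinuousBilinearMap
  have h : (fun X : E => R.ip X X) = fun X => b X X := rfl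
  rw [h]
  fun_prop

theorem continuous_nrm [FiniteDimensional ℝ E] : Continuous R.nrm :=
  Real.continuous_sqrt.comp R.continuous_ip_self

/-- The given norm of the model space is dominated by that of the scalar product. -/
theorem exists_norm_le_mul_nrm [FiniteDimensional ℝ E] : ∃ C : ℝ, ∀ X : E, ‖X‖ ≤ C * R.nrm X := by
  by_cases hE : (Metric.sphere (0 : E) 1).Nonempty
  · obtain ⟨X₀, hX₀, hmin⟩ := (isCompact_sphere (0 : E) 1).exists_isMinOn hE
      R.continuous_nrm.continuousOn
    have hpos : 0 < R.nrm X₀ := by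
      refine lt_of_le_of_ne (R.nrm_nonneg _) fun h => ?_
      have := R.eq_zero_of_nrm_eq_zero h.symm
      simp [this] at hX₀
    refine ⟨(R.nrm X₀)⁻¹, fun X => ?_⟩
    by_cases hX : X = 0
    · simp [hX]
    have hXn : 0 < ‖X‖ := norm_pos_iff.2 hX
    have h1 : R.nrm X₀ ≤ R.nrm (‖X‖⁻¹ • X) := hmin (by simp [norm_smul, hXn.ne'])
    rw [nrm_smul, abs_of_pos (inv_pos.2 hXn)] at h1
    rw [inv_mul_eq_div, le_div_iff₀ hpos]
    calc ‖X‖ * R.nrm X₀ ≤ ‖X‖ * (‖X‖⁻¹ * R.nrm X) := by gcongr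
      _ = R.nrm X := by field_simp
  · refine ⟨0, fun X => ?_⟩
    by_contra hX
    have hX : X ≠ 0 := by rintro rfl; simp at hX
    exact hE ⟨‖X‖⁻¹ • X, by simp [norm_smul, norm_ne_zero_iff.2 hX]⟩

end Algebra

/-! ### One-parameter groups of the adjoint representation -/

section Adjoint

variable {E : Type*} [NormedAddCommGroup E] [NormedSpace ℝ E] [FiniteDimensional ℝ E]
  {G : Type*} [TopologicalSpace G] [ChartedSpace E G] [Group G] [LieGroup 𝓘(ℝ, E) ∞ G] [T2Space G]

instance completeSpace_model : CompleteSpace E := FiniteDimensional.complete ℝ E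

variable (G) in
/-- The operator `ad X`, as the differential at `0` of `t ↦ Ad (exp (t X))`. -/
def adOp (X : E) : E →L[ℝ] E := deriv (fun t : ℝ => adG E (expG G (t • X))) 0

theorem hasDerivAt_adG_expG_zero (X : E) :
    HasDerivAt (fun t : ℝ => adG E (expG G (t • X))) (adOp G X) 0 := by
  have h1 := (hasVelocityAt_expG_zero (G := G) X).comp_map
    ((contMDiffAt_adG (E := E) (expG G ((0 : ℝ) • X))).mdifferentiableAt (by simp))
  exact (hasVelocityAt_iff_hasDerivAt.1 h1).differentiableAt.hasDerivAt

theorem adOp_apply (X Y : E) : adOp G X Y = bracketG G X Y := by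
  have h := (hasDerivAt_adG_expG_zero (G := G) X).clm_apply (hasDerivAt_const (0 : ℝ) Y)
  rw [map_zero, add_zero] at h
  exact h.unique (hasDerivAt_adG_zero X Y)

theorem adOp_skew (X Y : E) : adOp G X Y = -adOp G Y X := by
  rw [adOp_apply, adOp_apply]
  exact VectorField.mlieBracket_swap_apply

theorem adOp_neg (X Y : E) : adOp G (-X) Y = -adOp G X Y := by
  rw [adOp_skew, map_neg, neg_neg, adOp_skew]

theorem adG_expG_add (X : E) (a b : ℝ) (Y : E) :
    adG E (expG G ((a + b) • X)) Y = adG E (expG G (a • X)) (adG E (expG G (b • X)) Y) := by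
  rw [expG_add_smul, adG_mul]

theorem hasDerivAt_adG_expG (X Y : E) (t : ℝ) :
    HasDerivAt (fun t : ℝ => adG E (expG G (t • X)) Y) (adG E (expG G (t • X)) (adOp G X Y)) t := by
  have h := (hasDerivAt_adG_expG_zero (G := G) X).clm_apply (hasDerivAt_const (0 : ℝ) Y)
  rw [map_zero, add_zero] at h
  have h0 : HasDerivAt (fun t : ℝ => adG E (expG G (t • X)) Y) (adOp G X Y) (t - t) := by
    rwa [sub_self]
  have h2 := (adG E (expG G (t • X))).hasFDerivAt.comp_hasDerivAt t (h0.comp_sub_const t t)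
  have h3 : (fun u : ℝ => adG E (expG G (u • X)) Y) =
      (adG E (expG G (t • X))) ∘ (fun u : ℝ => adG E (expG G ((u - t) • X)) Y) := by
    ext u
    simp only [Function.comp_apply, ← adG_expG_add, add_sub_cancel]
  rw [h3]
  exact h2

theorem adG_expG_adOp (X Y : E) (t : ℝ) :
    adG E (expG G (t • X)) (adOp G X Y) = adOp G X (adG E (expG G (t • X)) Y) := by
  have h := (hasDerivAt_adG_expG_zero (G := G) X).clm_apply
    (hasDerivAt_const (0 : ℝ) (adG E (expG G (t • X)) Y))
  rw [map_zero, add_zero] at h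
  have h1 : HasDerivAt (fun u : ℝ => adG E (expG G (u • X)) Y)
      (adG E (expG G (t • X)) (adOp G X Y)) (0 + t) := by
    rw [zero_add]; exact hasDerivAt_adG_expG X Y t
  have h2 := h1.comp_add_const 0 t
  simp only [adG_expG_add] at h2
  exact h2.unique h

theorem adG_expG_eq_self {X Y : E} (h : adOp G X Y = 0) (t : ℝ) :
    adG E (expG G (t • X)) Y = Y := by
  have h1 : ∀ u, HasDerivAt (fun t : ℝ => adG E (expG G (t • X)) Y) 0 u := fun u => by
    simpa [h] using hasDerivAt_adG_expG (G := G) X Y u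
  have := is_const_of_deriv_eq_zero (fun u => (h1 u).differentiableAt) (fun u => (h1 u).deriv) t 0
  simpa using this

variable (R : RealReductiveGroup E G)

theorem th_adOp {X : E} (hX : R.th X = -X) (Y : E) : R.th (adOp G X Y) = -adOp G X (R.th Y) := by
  have h : R.th (bracketG G X Y) = bracketG G (R.th X) (R.th Y) := R.θ_bracket X Y
  rw [adOp_apply, h, hX, ← adOp_apply, adOp_neg]

/-- For `X` in `𝔪`, the Cartan involution conjugates `Ad (exp (t X))` to its inverse. -/
theorem th_adG_expG {X : E} (hX : R.th X = -X) (t : ℝ) (Y : E) :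
    R.th (adG E (expG G (t • X)) Y) = adG E (expG G (-t • X)) (R.th Y) := by
  let θ : E →L[ℝ] E := R.th.toContinuousLinearMap
  have hθ (Z : E) : θ Z = R.th Z := rfl
  have hd : ∀ u, HasDerivAt (fun u : ℝ => adG E (expG G (u • X)) (θ (adG E (expG G (u • X)) Y)))
      0 u := by
    intro u
    have h1 : HasDerivAt (fun u : ℝ => adG E (expG G (u • X)))
        ((adG E (expG G (u • X))).comp (adOp G X)) u := by
      have h0 : HasDerivAt (fun t : ℝ => adG E (expG G (t • X))) (adOp G X) (u - u) := by
        rw [sub_self]; exact hasDerivAt_adG_expG_zero X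
      have h2 := ((ContinuousLinearMap.compL ℝ E E E)
        (adG E (expG G (u • X)))).hasFDerivAt.comp_hasDerivAt u (h0.comp_sub_const u u)
      refine h2.congr_of_eventuallyEq (Eventually.of_forall fun v => ?_)
      ext Z
      simp only [Function.comp_apply, ContinuousLinearMap.compL_apply,
        ContinuousLinearMap.comp_apply, ← adG_expG_add, add_sub_cancel]
    have h2 := h1.clm_apply (θ.hasFDerivAt.comp_hasDerivAt u (hasDerivAt_adG_expG (G := G) X Y u))
    refine h2.congr_deriv ?_
    rw [ContinuousLinearMap.comp_apply, ← map_add, adG_expG_adOp]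
    simp only [Function.comp_apply, hθ, R.th_adOp hX, add_neg_cancel, map_zero]
  have h0 := is_const_of_deriv_eq_zero (fun u => (hd u).differentiableAt)
    (fun u => (hd u).deriv) t 0
  simp only [zero_smul, expG_zero, adG_one, hθ] at h0
  rw [← h0, neg_smul, expG_neg, adG_inv_apply]

/-- For `X` in `𝔪`, the operator `Ad (exp (t X))` is symmetric. -/
theorem ip_adG_expG {X : E} (hX : R.th X = -X) (t : ℝ) (Y Z : E) :
    R.ip (adG E (expG G (t • X)) Y) Z = R.ip Y (adG E (expG G (t • X)) Z) := by
  rw [ip_apply, ip_apply, R.th_adG_expG hX, ← R.bil_adG (expG G (t • X)), neg_smul, expG_neg,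
    adG_apply_inv]

theorem hasDerivAt_ip {f : ℝ → E} {f' : E} {t : ℝ} (hf : HasDerivAt f f' t) (Z : E) :
    HasDerivAt (fun u => R.ip (f u) Z) (R.ip f' Z) t :=
  (R.ip.flip Z).toContinuousLinearMap.hasFDerivAt.comp_hasDerivAt t hf

theorem ip_adOp {X : E} (hX : R.th X = -X) (Y Z : E) :
    R.ip (adOp G X Y) Z = R.ip Y (adOp G X Z) := by
  have h1 := R.hasDerivAt_ip (hasDerivAt_adG_expG (G := G) X Y 0) Z
  have h2 := R.hasDerivAt_ip (hasDerivAt_adG_expG (G := G) X Z 0) Y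
  simp only [zero_smul, expG_zero, adG_one] at h1 h2
  have h3 : (fun u : ℝ => R.ip (adG E (expG G (u • X)) Y) Z) =
      fun u => R.ip (adG E (expG G (u • X)) Z) Y := by
    ext u; rw [R.ip_adG_expG hX, ip_symm]
  rw [h3] at h1
  rw [h1.unique h2, ip_symm]

/-- On the eigenvectors of the Cartan involution, the quadratic form of the positive operator
`Ad (exp (t X))`, for `X` in `𝔪`, is at least that of the identity. -/
theorem ip_self_le_ip_adG_expG {X Z : E} (hX : R.th X = -X) (hZ : R.th Z = Z ∨ R.th Z = -Z)
    (t : ℝ) : R.ip Z Z ≤ R.ip (adG E (expG G (t • X)) Z) Z := by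
  set a := adG E (expG G ((t / 2) • X)) Z with ha
  set b := adG E (expG G (-(t / 2) • X)) Z with hb
  have h1 : R.ip (adG E (expG G (t • X)) Z) Z = R.ip a a := by
    rw [← add_halves t, adG_expG_add, R.ip_adG_expG hX, ← ha]
  have h2 : R.ip a b = R.ip Z Z := by
    rw [ha, R.ip_adG_expG hX, hb, ← adG_expG_add, add_neg_cancel, zero_smul, expG_zero, adG_one]
  have h3 : R.ip b b = R.ip a a := by
    rw [← R.ip_th a a, ha, R.th_adG_expG hX]
    rcases hZ with hZ | hZ
    · rw [hZ]
    · rw [hZ]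
      simp only [map_neg, ← hb, LinearMap.neg_apply, neg_neg]
  have h4 := R.ip_self_nonneg (a - b)
  simp only [map_sub, LinearMap.sub_apply, R.ip_symm b a, h2, h3] at h4
  linarith

/-- The function `t ↦ ⟨Ad (exp (t X)) Z, [X, Z]⟩` vanishes at `0`, and its derivative is at least
`|[X, Z]|²`. -/
theorem ip_adOp_le {X Z : E} (hX : R.th X = -X) (hZ : R.th Z = Z ∨ R.th Z = -Z) :
    R.ip (adOp G X Z) (adOp G X Z) ≤ R.ip (adG E (expG G X) Z) (adOp G X Z) := by
  set W := adOp G X Z with hW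
  have hW' : R.th W = W ∨ R.th W = -W := by
    rw [hW, R.th_adOp hX]
    rcases hZ with hZ | hZ <;> simp [hZ]
  have h0 : R.ip Z W = 0 := by
    rcases hZ with hZ | hZ
    · exact R.ip_eq_zero hZ (by rw [hW, R.th_adOp hX, hZ])
    · exact R.ip_eq_zero' hZ (by rw [hW, R.th_adOp hX, hZ, map_neg, neg_neg])
  have hd (t : ℝ) := R.hasDerivAt_ip (hasDerivAt_adG_expG (G := G) X Z t) W
  rw [← hW] at hd
  have h := mul_sub_le_image_sub_of_le_deriv (f := fun t : ℝ => R.ip (adG E (expG G (t • X)) Z) W)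
    (C := R.ip W W) (fun t => (hd t).differentiableAt)
    (fun t => by rw [(hd t).deriv]; exact R.ip_self_le_ip_adG_expG hX hW' t) zero_le_one
  simpa [h0] using h

/-- If `Ad (exp X)` maps a vector of `𝔪` into `𝔪`, for some `X` in `𝔪`, then this vector
commutes with `X`. -/
theorem adOp_eq_zero {X Z : E} (hX : R.th X = -X) (hZ : R.th Z = -Z)
    (h : ∀ K, R.th K = K → R.ip (adG E (expG G X) Z) K = 0) : adOp G X Z = 0 := by
  have h1 := R.ip_adOp_le hX (Or.inr hZ)
  rw [h _ (by rw [R.th_adOp hX, hZ, map_neg, neg_neg])] at h1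
  exact R.eq_zero_of_ip_self_eq_zero (le_antisymm h1 (R.ip_self_nonneg _))

end Adjoint

end RealReductiveGroup

/-! ### The polar projection and its differential -/

namespace RealReductiveGroup

variable {E : Type*} [NormedAddCommGroup E] [NormedSpace ℝ E] [FiniteDimensional ℝ E]
  {G : Type*} [TopologicalSpace G] [ChartedSpace E G] [Group G] [LieGroup 𝓘(ℝ, E) ∞ G] [T2Space G]
  (R : RealReductiveGroup E G)

/-- The polar projection `G → 𝔪`, which maps `h * exp X` to `X`. -/
def polarLog : G → E := R.polar.choose

theorem contMDiff_polarLog : ContMDiff 𝓘(ℝ, E) 𝓘(ℝ, E) ∞ R.polarLog := R.polar.choose_spec.1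

theorem eq_polarLog_iff {g : G} {X : E} :
    (R.th X = -X ∧ g * (expG G X)⁻¹ ∈ R.H) ↔ X = R.polarLog g := R.polar.choose_spec.2 g X

theorem th_polarLog (g : G) : R.th (R.polarLog g) = -R.polarLog g := (R.eq_polarLog_iff.2 rfl).1

theorem mul_expG_polarLog_inv_mem (g : G) : g * (expG G (R.polarLog g))⁻¹ ∈ R.H :=
  (R.eq_polarLog_iff.2 rfl).2

theorem polarLog_mul {h : G} (hh : h ∈ R.H) (g : G) : R.polarLog (h * g) = R.polarLog g := by
  refine (R.eq_polarLog_iff.1 ⟨R.th_polarLog g, ?_⟩).symm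
  rw [mul_assoc]
  exact R.H.mul_mem hh (R.mul_expG_polarLog_inv_mem g)

theorem polarLog_expG {X : E} (hX : R.th X = -X) : R.polarLog (expG G X) = X :=
  (R.eq_polarLog_iff.1 ⟨hX, by rw [mul_inv_cancel]; exact R.H.one_mem⟩).symm

theorem exists_eq_mul_expG_polarLog (g : G) : ∃ h ∈ R.H, g = h * expG G (R.polarLog g) :=
  ⟨_, R.mul_expG_polarLog_inv_mem g, by simp⟩

@[simp] theorem polarLog_one : R.polarLog (1 : G) = 0 := by
  simpa using R.polarLog_expG (X := 0) (by simp)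

theorem mem_H_of_polarLog_eq_zero {g : G} (h : R.polarLog g = 0) : g ∈ R.H := by
  have := R.mul_expG_polarLog_inv_mem g
  rwa [h, expG_zero, inv_one, mul_one] at this

theorem th_eq_self_iff {K : E} : R.th K = K ↔ ∀ t : ℝ, expG G (t • K) ∈ R.H := R.θ_eq_iff K

theorem th_adG_of_th_eq {h : G} (hh : h ∈ R.H) {K : E} (hK : R.th K = K) :
    R.th (adG E h K) = adG E h K := by
  rw [th_eq_self_iff] at hK ⊢
  intro t
  rw [← map_smul, ← conj_expG]
  exact R.H.mul_mem (R.H.mul_mem hh (hK t)) (R.H.inv_mem hh)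

theorem th_adG_of_th_eq_neg {h : G} (hh : h ∈ R.H) {X : E} (hX : R.th X = -X) :
    R.th (adG E h X) = -adG E h X := by
  set U := adG E h X - R.pr (adG E h X) with hU
  have hU1 : R.th U = U := R.th_sub_pr _
  have h1 : R.bil U (adG E h X) = 0 := by
    rw [← R.bil_adG h⁻¹, adG_inv_apply]
    have h2 := R.ip_eq_zero (R.th_adG_of_th_eq (R.H.inv_mem hh) hU1) hX
    rwa [ip_apply, R.th_adG_of_th_eq (R.H.inv_mem hh) hU1, neg_eq_zero] at h2
  have h2 : R.ip U U = 0 := by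
    have h3 := R.ip_eq_zero hU1 (R.th_pr (adG E h X))
    have h4 : R.ip U U = R.ip U (adG E h X) - R.ip U (R.pr (adG E h X)) := by
      rw [← map_sub]
    rw [h4, h3, ip_apply, hU1, h1]; simp
  have h3 : adG E h X = R.pr (adG E h X) := sub_eq_zero.1 (R.eq_zero_of_ip_self_eq_zero h2)
  rw [h3, th_pr]

theorem th_adG {h : G} (hh : h ∈ R.H) (X : E) : R.th (adG E h X) = adG E h (R.th X) := by
  have h1 := R.th_adG_of_th_eq hh (R.th_sub_pr X)
  have h2 := R.th_adG_of_th_eq_neg hh (R.th_pr X)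
  have h3 : adG E h X = adG E h (X - R.pr X) + adG E h (R.pr X) := by rw [← map_add, sub_add_cancel]
  have h4 : R.th X = (X - R.pr X) - R.pr X := by
    conv_lhs => rw [← sub_add_cancel X (R.pr X)]
    rw [map_add, th_sub_pr, th_pr]
    abel
  rw [h3, map_add, h1, h2, h4]
  simp only [map_sub]
  abel

theorem pr_adG {h : G} (hh : h ∈ R.H) (X : E) : R.pr (adG E h X) = adG E h (R.pr X) := by
  rw [pr_apply, pr_apply, R.th_adG hh, map_smul, map_sub]

theorem ip_adG {h : G} (hh : h ∈ R.H) (X Y : E) : R.ip (adG E h X) (adG E h Y) = R.ip X Y := by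
  rw [ip_apply, ip_apply, R.th_adG hh, bil_adG]

theorem nrm_adG {h : G} (hh : h ∈ R.H) (X : E) : R.nrm (adG E h X) = R.nrm X := by
  rw [nrm, nrm, R.ip_adG hh]

theorem polarLog_mul_right (g : G) {k : G} (hk : k ∈ R.H) :
    R.polarLog (g * k) = adG E k⁻¹ (R.polarLog g) := by
  obtain ⟨h, hh, hg⟩ := R.exists_eq_mul_expG_polarLog g
  refine (R.eq_polarLog_iff.1 ⟨R.th_adG_of_th_eq_neg (R.H.inv_mem hk) (R.th_polarLog g), ?_⟩).symm
  rw [← conj_expG]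
  have : g * k * (k⁻¹ * expG G (R.polarLog g) * k⁻¹⁻¹)⁻¹ = g * (expG G (R.polarLog g))⁻¹ * k := by
    group
  rw [this]
  exact R.H.mul_mem (R.mul_expG_polarLog_inv_mem g) hk

/-- The differential at `1` of `x ↦ polarLog (x * g)`. -/
def dLog (g : G) : E →L[ℝ] E := diffAt E E (fun x => R.polarLog (x * g)) 1

theorem mdifferentiableAt_polarLog_mul (g x : G) :
    MDifferentiableAt 𝓘(ℝ, E) 𝓘(ℝ, E) (fun x => R.polarLog (x * g)) x :=
  MDifferentiableAt.comp x ((R.contMDiff_polarLog (x * g)).mdifferentiableAt (by simp))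
    (mdifferentiableAt_mul_right' g x)

theorem hasDerivAt_polarLog {a : ℝ → G} {V : E} {t : ℝ} (ha : HasVelocityAt a V t)
    (h1 : a t = 1) (g : G) : HasDerivAt (fun u => R.polarLog (a u * g)) (R.dLog g V) t := by
  have h := ha.comp_map (f := fun x => R.polarLog (x * g)) (R.mdifferentiableAt_polarLog_mul g _)
  rw [h1] at h
  exact hasVelocityAt_iff_hasDerivAt.1 h

theorem hasDerivAt_polarLog_expG (V : E) (g : G) :
    HasDerivAt (fun u : ℝ => R.polarLog (expG G (u • V) * g)) (R.dLog g V) 0 :=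
  R.hasDerivAt_polarLog (hasVelocityAt_expG_zero V) (by simp) g

theorem dLog_of_th_eq (g : G) {K : E} (hK : R.th K = K) : R.dLog g K = 0 := by
  have h := R.hasDerivAt_polarLog_expG K g
  simp only [R.polarLog_mul (R.th_eq_self_iff.1 hK _)] at h
  exact h.unique (hasDerivAt_const _ _)

theorem dLog_pr (g : G) (V : E) : R.dLog g (R.pr V) = R.dLog g V := by
  have h := R.dLog_of_th_eq g (R.th_sub_pr V)
  rwa [map_sub, sub_eq_zero, eq_comm] at h

theorem expG_add_of_adOp_eq_zero {X Z : E} (h : adOp G X Z = 0) :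
    expG G (X + Z) = expG G Z * expG G X := by
  have hc (a b : ℝ) : expG G (a • X) * expG G (b • Z) = expG G (b • Z) * expG G (a • X) := by
    rw [← mul_inv_eq_iff_eq_mul, conj_expG, map_smul, adG_expG_eq_self h]
  have h1 := eq_expG_of_hasVelocityAt_zero (c := fun t => expG G (t • Z) * expG G (t • X))
    (X := X + Z) (fun a b => ?_) ?_ 1
  · simpa using h1.symm
  · rw [expG_add_smul, expG_add_smul, mul_assoc, mul_assoc, ← mul_assoc (expG G (b • Z)), ← hc,
      mul_assoc]
  · rw [add_comm]
    exact (hasVelocityAt_expG_zero Z).mul_of_eq_one (hasVelocityAt_expG_zero X)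
      (by simp) (by simp)

theorem dLog_expG_of_adOp_eq_zero {X Z : E} (hX : R.th X = -X) (hZ : R.th Z = -Z)
    (h : adOp G X Z = 0) : R.dLog (expG G X) Z = Z := by
  have h1 := R.hasDerivAt_polarLog_expG Z (expG G X)
  have h2 : (fun u : ℝ => R.polarLog (expG G (u • Z) * expG G X)) = fun u => X + u • Z := by
    ext u
    rw [← expG_add_of_adOp_eq_zero (by rw [map_smul, h, smul_zero]), polarLog_expG]
    rw [map_add, map_smul, hX, hZ]; module
  rw [h2] at h1
  refine h1.unique ?_
  simpa using ((hasDerivAt_id (0 : ℝ)).smul_const Z).const_add X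

theorem dLog_expG_adG {X K : E} (hX : R.th X = -X) (hK : R.th K = K) :
    R.dLog (expG G X) (adG E (expG G X) K) = adOp G X K := by
  have h1 := R.hasDerivAt_polarLog_expG (adG E (expG G X) K) (expG G X)
  have h2 : (fun u : ℝ => R.polarLog (expG G (u • adG E (expG G X) K) * expG G X)) =
      fun u => adG E (expG G (u • -K)) X := by
    ext u
    rw [← map_smul, ← conj_expG, inv_mul_cancel_right,
      R.polarLog_mul_right _ (R.th_eq_self_iff.1 hK u), R.polarLog_expG hX, smul_neg, expG_neg]
  rw [h2] at h1
  refine h1.unique ?_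
  have h3 := hasDerivAt_adG_expG (G := G) (-K) X 0
  rwa [zero_smul, expG_zero, adG_one, adOp_neg, ← adOp_skew] at h3

/-- Every vector of `𝔪` is the sum of a vector of `𝔪` commuting with `X` and of the
`𝔪`-component of a vector of `Ad (exp X) 𝔥`. -/
theorem exists_eq_add_pr_adG {X V : E} (hX : R.th X = -X) (hV : R.th V = -V) :
    ∃ Z K : E, R.th Z = -Z ∧ adOp G X Z = 0 ∧ R.th K = K ∧ V = Z + R.pr (adG E (expG G X) K) := by
  let f : E →ₗ[ℝ] E := R.pr ∘ₗ (adG E (expG G X) : E →ₗ[ℝ] E)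
  let U : Submodule ℝ E := (LinearMap.eqLocus R.th LinearMap.id).map f
  have hrefl : R.ip.IsRefl := fun x y h => by rw [ip_symm, h]
  have hd : IsCompl U (R.ip.orthogonal U) := by
    rw [LinearMap.BilinForm.isCompl_orthogonal_iff_disjoint hrefl, Submodule.disjoint_def]
    intro x hx hx'
    exact R.eq_zero_of_ip_self_eq_zero (hx' x hx)
  obtain ⟨u, hu, z, hz, huz⟩ := Submodule.mem_sup.1 (hd.sup_eq_top ▸ Submodule.mem_top : V ∈ _)
  obtain ⟨K, hK, rfl⟩ := hu
  have hK : R.th K = K := hK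
  have hfK : R.th (f K) = -f K := R.th_pr _
  have hz1 : R.th z = -z := by
    rw [← eq_sub_iff_add_eq'] at huz
    rw [huz, map_sub, hV, hfK]; module
  refine ⟨z, K, hz1, R.adOp_eq_zero hX hz1 fun K' hK' => ?_, hK, ?_⟩
  · have h1 : R.ip (f K') z = 0 := hz _ ⟨K', hK', rfl⟩
    have h2 := R.ip_eq_zero (R.th_sub_pr (adG E (expG G X) K')) hz1
    have h3 := R.ip_adG_expG hX 1 z K'
    rw [map_sub, LinearMap.sub_apply] at h2
    rw [one_smul] at h3
    rw [h3, ip_symm, sub_eq_zero.1 h2]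
    exact h1
  · rw [add_comm]; exact huz.symm

/-- At `exp X` with `X` in `𝔪`, the differential of the polar projection, restricted to `𝔪`, is
given by `Z + pr (Ad (exp X) K) ↦ Z + [X, K]`. -/
theorem dLog_expG_add {X Z K : E} (hX : R.th X = -X) (hZ : R.th Z = -Z) (hXZ : adOp G X Z = 0)
    (hK : R.th K = K) : R.dLog (expG G X) (Z + R.pr (adG E (expG G X) K)) = Z + adOp G X K := by
  rw [map_add, R.dLog_expG_of_adOp_eq_zero hX hZ hXZ, dLog_pr, R.dLog_expG_adG hX hK]

theorem th_dLog_expG {X V : E} (hX : R.th X = -X) :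
    R.th (R.dLog (expG G X) V) = -R.dLog (expG G X) V := by
  obtain ⟨Z, K, hZ, hXZ, hK, hV⟩ := R.exists_eq_add_pr_adG hX (R.th_pr V)
  rw [← dLog_pr, hV, R.dLog_expG_add hX hZ hXZ hK, map_add, hZ, R.th_adOp hX, hK]
  module

/-- The polar projection is infinitesimally contracting: this is the nonpositive curvature of the
symmetric space. -/
theorem nrm_dLog_expG_le {X : E} (hX : R.th X = -X) (V : E) :
    R.nrm (R.dLog (expG G X) V) ≤ R.nrm (R.pr V) := by
  obtain ⟨Z, K, hZ, hXZ, hK, hV⟩ := R.exists_eq_add_pr_adG hX (R.th_pr V)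
  rw [← dLog_pr, hV, R.dLog_expG_add hX hZ hXZ hK]
  set S := adOp G X K with hS
  set A := adG E (expG G X) K with hA
  have hSm : R.th S = -S := by rw [hS, R.th_adOp hX, hK]
  have h1 : R.ip Z S = 0 := by rw [hS, ← R.ip_adOp hX, hXZ]; simp
  have hpr (W : E) (hW : R.th W = -W) : R.ip (R.pr A) W = R.ip A W := by
    have := R.ip_eq_zero (R.th_sub_pr A) hW
    rw [map_sub, LinearMap.sub_apply, sub_eq_zero] at this
    exact this.symm
  have h2 : R.ip (R.pr A) Z = 0 := by
    have h3 := R.ip_adG_expG hX 1 K Z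
    rw [adG_expG_eq_self hXZ, one_smul] at h3
    rw [hpr Z hZ, hA, h3, R.ip_eq_zero hK hZ]
  have h3 : R.ip S S ≤ R.ip (R.pr A) S := by
    rw [hpr S hSm]; exact R.ip_adOp_le hX (Or.inl hK)
  refine R.nrm_le_of_sq_le_ip ?_
  simp only [map_add, LinearMap.add_apply, h1, h2, R.ip_symm S Z]
  linarith

theorem nrm_dLog_le (g : G) (V : E) : R.nrm (R.dLog g V) ≤ R.nrm (R.pr V) := by
  obtain ⟨h, hh, hg⟩ := R.exists_eq_mul_expG_polarLog g
  have hi := R.H.inv_mem hh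
  have h1 : R.dLog g V = R.dLog (expG G (R.polarLog g)) (adG E h⁻¹ V) := by
    have h2 := R.hasDerivAt_polarLog_expG V g
    refine h2.unique ?_
    have h3 := R.hasDerivAt_polarLog (hasVelocityAt_conj (hasVelocityAt_expG_zero (G := G) V)
      (by simp) h⁻¹) (by simp) (expG G (R.polarLog g))
    have h4 : (fun u : ℝ => R.polarLog (h⁻¹ * expG G (u • V) * h⁻¹⁻¹ * expG G (R.polarLog g))) =
        fun u => R.polarLog (expG G (u • V) * g) := by
      ext u
      rw [inv_inv, mul_assoc, ← hg, mul_assoc, R.polarLog_mul hi]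
    rwa [h4] at h3
  rw [h1, ← R.nrm_adG hi (R.pr V), ← R.pr_adG hi]
  exact R.nrm_dLog_expG_le (R.th_polarLog g) _

theorem eq_zero_of_dLog_expG_eq_zero {X V : E} (hX : R.th X = -X) (hV : R.th V = -V)
    (h : R.dLog (expG G X) V = 0) : V = 0 := by
  obtain ⟨Z, K, hZ, hXZ, hK, hV⟩ := R.exists_eq_add_pr_adG hX hV
  rw [hV, R.dLog_expG_add hX hZ hXZ hK] at h
  have h1 : R.ip Z (adOp G X K) = 0 := by rw [← R.ip_adOp hX, hXZ]; simp
  have h2 : R.ip Z (Z + adOp G X K) = 0 := by rw [h, map_zero]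
  rw [map_add, h1, add_zero] at h2
  have hZ0 := R.eq_zero_of_ip_self_eq_zero h2
  rw [hZ0, zero_add] at h
  have h3 := adG_expG_eq_self h 1
  rw [one_smul] at h3
  rw [hV, hZ0, h3, R.pr_eq_zero hK, zero_add]

end RealReductiveGroup

/-! ### Lengths of curves and the distance of the symmetric space -/

section Curves

variable {E : Type*} [NormedAddCommGroup E] [NormedSpace ℝ E]
  {G : Type*} [TopologicalSpace G] [ChartedSpace E G] [Group G] [LieGroup 𝓘(ℝ, E) ∞ G]

variable (E) in
/-- The right-trivialized velocity of a curve, with values in the model space. -/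
def rightVel (c : ℝ → G) (t : ℝ) : E := rightVelocity E c t

theorem hasVelocityAt_rightVel {c : ℝ → G} {t : ℝ} (hc : MDifferentiableAt 𝓘(ℝ, ℝ) 𝓘(ℝ, E) c t) :
    HasVelocityAt (fun u => c u * (c t)⁻¹) (rightVel E c t) t :=
  hasVelocityAt_diffAt ((mdifferentiableAt_mul_right' (c t)⁻¹ (c t)).comp t hc)

theorem continuous_rightVel {c : ℝ → G} (hc : ContMDiff 𝓘(ℝ, ℝ) 𝓘(ℝ, E) 1 c) :
    Continuous (rightVel E c) := by
  have h : Continuous fun t => diffAt ℝ E (fun u => c u * (c t)⁻¹) t := by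
    refine continuous_iff_continuousAt.2 fun t₀ => ?_
    have h1 : ContMDiff (𝓘(ℝ, ℝ).prod 𝓘(ℝ, ℝ)) 𝓘(ℝ, E) 1
        (fun q : ℝ × ℝ => c q.2 * (c q.1)⁻¹) := by
      have : LieGroup 𝓘(ℝ, E) 1 G := LieGroup.of_le (n := ∞) (by simp)
      exact (hc.comp contMDiff_snd).mul (hc.comp contMDiff_fst).inv
    exact (contMDiffAt_diffAt_curve (m := 0) (f := fun t u => c u * (c t)⁻¹) (q := 1)
      h1.contMDiffAt (fun t => mul_inv_cancel _) (by simp)).continuousAt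
  exact h.clm_apply continuous_const

variable [CompleteSpace E] [T2Space G]

theorem contMDiffAt_expG_smul_zero (X : E) :
    ContMDiffAt 𝓘(ℝ, ℝ) 𝓘(ℝ, E) 1 (fun t : ℝ => expG G (t • X)) 0 := by
  set c := fun t : ℝ => expG G (t • X) with hc
  have hc0 : c 0 = 1 := by simp [hc]
  have hcc : Continuous c := continuous_expG_smul X
  set β := fun t : ℝ => chartOne E G (c t) with hβ
  have hsrc : ∀ᶠ t in 𝓝 (0 : ℝ), c t ∈ (chartOne E G).source :=
    hcc.continuousAt.eventually (by rw [hc0]; exact extChartAt_source_mem_nhds (1 : G))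
  have hβ0 : HasDerivAt β X 0 := by
    have h := (hasVelocityAt_expG_zero (G := G) X).comp_map (f := chartOne E G)
      (by
        rw [zero_smul, expG_zero]
        exact (contMDiffAt_extChartAt (n := 1)).mdifferentiableAt (by simp))
    simp only [zero_smul, expG_zero, diffAt_chartOne_one] at h
    exact hasVelocityAt_iff_hasDerivAt.1 h
  have hβc : ContinuousAt β 0 := hβ0.continuousAt
  have he : ∀ᶠ q in 𝓝 (chartOne E G 1, chartOne E G 1), ContDiffAt ℝ 2 (chartMul E G) q :=
    (contDiffAt_chartMul.of_le ENat.LEInfty.out).eventually (by simp)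
  have hb : Tendsto (fun t => (β t, chartOne E G 1)) (𝓝 0)
      (𝓝 (chartOne E G 1, chartOne E G 1)) := by
    have := hβc.prodMk (continuousAt_const (y := chartOne E G 1))
    simpa [ContinuousAt, hβ, hc0] using this
  have hder : ∀ᶠ t in 𝓝 (0 : ℝ),
      HasDerivAt β (fderiv ℝ (chartMul E G) (β t, chartOne E G 1) (0, X)) t := by
    filter_upwards [hsrc, hb.eventually he] with t ht h2
    have h3 : HasDerivAt (fun h => (β t, β h)) ((0 : E), X) 0 :=
      (hasDerivAt_const _ _).prodMk hβ0
    have h4 : HasFDerivAt (chartMul E G) (fderiv ℝ (chartMul E G) (β t, chartOne E G 1))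
        (β t, β 0) := by
      simp only [hβ, hc0]
      exact (h2.differentiableAt (by simp)).hasFDerivAt
    have h5 := h4.comp_hasDerivAt (0 : ℝ) h3
    have h6 : HasDerivAt (fun u => β (t + u)) (fderiv ℝ (chartMul E G) (β t, chartOne E G 1) (0, X))
        0 := by
      refine h5.congr_of_eventuallyEq ?_
      filter_upwards [hsrc] with h hh
      simp only [hβ, Function.comp_apply, chartMul]
      rw [PartialEquiv.left_inv _ ht, PartialEquiv.left_inv _ hh]
      simp only [hc, expG_add_smul]
    have h7 : HasDerivAt (fun u => β (t + u))
        (fderiv ℝ (chartMul E G) (β t, chartOne E G 1) (0, X)) (-t + t) := by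
      rwa [neg_add_cancel]
    simpa using h7.comp_const_add (-t) t
  have h1 : ContDiffAt ℝ 1 β 0 := by
    rw [contDiffAt_one_iff]
    obtain ⟨u, hu, huo, h0⟩ := eventually_nhds_iff.1 (hder.and (hb.eventually he))
    refine ⟨fun t => ContinuousLinearMap.toSpanSingleton ℝ
      (fderiv ℝ (chartMul E G) (β t, chartOne E G 1) (0, X)), u, huo.mem_nhds h0, ?_,
      fun t ht => (hu t ht).1.hasFDerivAt⟩
    intro t ht
    refine ContinuousAt.continuousWithinAt ?_
    have h1 : ContinuousAt (fderiv ℝ (chartMul E G)) (β t, chartOne E G 1) :=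
      ((hu t ht).2.fderiv_right (m := 1) (by norm_num)).continuousAt
    have h2 : ContinuousAt (fun t => fderiv ℝ (chartMul E G) (β t, chartOne E G 1)) t :=
      ContinuousAt.comp (f := fun t => (β t, chartOne E G 1)) h1
        ((hu t ht).1.continuousAt.prodMk continuousAt_const)
    exact (ContinuousLinearMap.toSpanSingletonCLE (𝕜 := ℝ) (E := E)).continuous.continuousAt.comp
      (h2.clm_apply continuousAt_const)
  have h2 : ContMDiffAt 𝓘(ℝ, ℝ) 𝓘(ℝ, E) 1 ((chartOne E G).symm ∘ β) 0 := by
    refine ContMDiffAt.comp 0 ?_ h1.contMDiffAt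
    simp only [hβ, hc0]
    exact contMDiffAt_chartOne_symm.of_le (by simp)
  refine h2.congr_of_eventuallyEq ?_
  filter_upwards [hsrc] with t ht
  simp [hβ, PartialEquiv.left_inv _ ht]

theorem contMDiff_expG_smul (X : E) :
    ContMDiff 𝓘(ℝ, ℝ) 𝓘(ℝ, E) 1 (fun t : ℝ => expG G (t • X)) := by
  intro t
  have h : (fun u : ℝ => expG G (u • X)) =
      fun u => expG G (t • X) * expG G ((u - t) • X) := by
    ext u; rw [← expG_add_smul]; simp
  have : LieGroup 𝓘(ℝ, E) 1 G := LieGroup.of_le (n := ∞) (by simp)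
  rw [h]
  refine contMDiffAt_const.mul (ContMDiffAt.comp (I' := 𝓘(ℝ, ℝ))
    (g := fun v : ℝ => expG G (v • X)) (f := fun u : ℝ => u - t) t ?_ ?_)
  · rw [sub_self]; exact contMDiffAt_expG_smul_zero X
  · exact (contDiff_id.sub contDiff_const).contMDiff.contMDiffAt

theorem rightVel_expG_smul_mul (X : E) (g : G) (t : ℝ) :
    rightVel E (fun u : ℝ => expG G (u • X) * g) t = X := by
  have h : (fun u : ℝ => expG G (u • X) * g * (expG G (t • X) * g)⁻¹) =
      fun u => expG G ((u - t) • X) := by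
    ext u
    rw [sub_eq_add_neg, expG_add_smul, neg_smul, expG_neg]; group
  have h1 : HasVelocityAt (fun u : ℝ => expG G (u • X)) X (t - t) := by
    rw [sub_self]; exact hasVelocityAt_expG_zero X
  have h2 := h1.comp_real (f := fun u => u - t) ((hasDerivAt_id t).sub_const t)
  have h3 : rightVel E (fun u : ℝ => expG G (u • X) * g) t =
      diffAt ℝ E (fun u : ℝ => expG G (u • X) * g * (expG G (t • X) * g)⁻¹) t 1 := rfl
  rw [h3, h, h2.diffAt_apply_one, one_smul]

end Curves

namespace RealReductiveGroup

variable {E : Type*} [NormedAddCommGroup E] [NormedSpace ℝ E] [FiniteDimensional ℝ E]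
  {G : Type*} [TopologicalSpace G] [ChartedSpace E G] [Group G] [LieGroup 𝓘(ℝ, E) ∞ G] [T2Space G]
  (R : RealReductiveGroup E G)

theorem curveLength_eq (c : ℝ → G) :
    R.curveLength c = ∫ t in (0 : ℝ)..1, R.nrm (R.pr (rightVel E c t)) := by
  have h : (fun t => R.nrm (R.pr (rightVel E c t))) =
      fun t => Real.sqrt (R.bil (R.pr (rightVel E c t)) (R.pr (rightVel E c t))) := by
    ext t; rw [nrm, R.ip_eq_bil (R.th_pr _)]
  rw [h]; rfl

theorem curveLength_nonneg (c : ℝ → G) : 0 ≤ R.curveLength c :=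
  intervalIntegral.integral_nonneg zero_le_one fun _ _ => Real.sqrt_nonneg _

theorem curveLength_expG (X : E) (g : G) :
    R.curveLength (fun u : ℝ => expG G (u • X) * g) = R.nrm (R.pr X) := by
  simp [curveLength_eq, rightVel_expG_smul_mul]

theorem curveLength_mul_right (c : ℝ → G) (g : G) :
    R.curveLength (fun u => c u * g) = R.curveLength c := by
  have h : rightVel E (fun u => c u * g) = rightVel E c := by
    ext1 t
    have h1 : (fun u => c u * g * (c t * g)⁻¹) = fun u => c u * (c t)⁻¹ := by ext u; group
    have h2 : rightVel E (fun u => c u * g) t =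
      diffAt ℝ E (fun u => c u * g * (c t * g)⁻¹) t 1 := rfl
    rw [h2, h1]; rfl
  rw [curveLength_eq, curveLength_eq, h]

/-- The polar projection does not increase lengths. -/
theorem nrm_polarLog_sub_le_curveLength {c : ℝ → G} (hc : ContMDiff 𝓘(ℝ, ℝ) 𝓘(ℝ, E) 1 c) :
    R.nrm (R.polarLog (c 1) - R.polarLog (c 0)) ≤ R.curveLength c := by
  set Y := R.polarLog (c 1) - R.polarLog (c 0) with hY
  have hder (t : ℝ) : HasDerivAt (fun u => R.polarLog (c u)) (R.dLog (c t) (rightVel E c t)) t := by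
    have h := R.hasDerivAt_polarLog
      (hasVelocityAt_rightVel (t := t) (hc.mdifferentiableAt (by simp))) (mul_inv_cancel _) (c t)
    simpa using h
  let L : E →L[ℝ] ℝ := (R.ip Y).toContinuousLinearMap
  have hder' (t : ℝ) : HasDerivAt (fun u => R.ip Y (R.polarLog (c u)))
      (R.ip Y (R.dLog (c t) (rightVel E c t))) t :=
    L.hasFDerivAt.comp_hasDerivAt t (hder t)
  have hcont : Continuous fun t => R.nrm Y * R.nrm (R.pr (rightVel E c t)) :=
    continuous_const.mul (R.continuous_nrm.comp
      (R.pr.continuous_of_finiteDimensional.comp (continuous_rightVel hc)))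
  have h := intervalIntegral.sub_le_integral_of_hasDeriv_right_of_le (zero_le_one' ℝ)
    (fun t _ => (hder' t).continuousAt.continuousWithinAt)
    (fun t _ => (hder' t).hasDerivWithinAt) (hcont.continuousOn.integrableOn_Icc)
    (fun t _ => (R.ip_le _ _).trans
      (mul_le_mul_of_nonneg_left (R.nrm_dLog_le _ _) (R.nrm_nonneg Y)))
  rw [← map_sub, ← hY, intervalIntegral.integral_const_mul, ← curveLength_eq, ← nrm_sq] at h
  by_contra! hlt
  have h0 : 0 < R.nrm Y := (R.curveLength_nonneg c).trans_lt hlt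
  nlinarith

end RealReductiveGroup

namespace RealReductiveGroup

variable {E : Type*} [NormedAddCommGroup E] [NormedSpace ℝ E] [FiniteDimensional ℝ E]
  {G : Type*} [TopologicalSpace G] [ChartedSpace E G] [Group G] [LieGroup 𝓘(ℝ, E) ∞ G] [T2Space G]
  (R : RealReductiveGroup E G)

/-- The displacement of the base point by `g`: the norm of the polar projection of `g`. -/
def len (g : G) : ℝ := R.nrm (R.polarLog g)

theorem len_nonneg (g : G) : 0 ≤ R.len g := R.nrm_nonneg _

theorem continuous_len : Continuous R.len := R.continuous_nrm.comp R.contMDiff_polarLog.continuous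

theorem len_mul_left {h : G} (hh : h ∈ R.H) (g : G) : R.len (h * g) = R.len g := by
  rw [len, R.polarLog_mul hh, len]

theorem len_mul_right (g : G) {h : G} (hh : h ∈ R.H) : R.len (g * h) = R.len g := by
  rw [len, R.polarLog_mul_right _ hh, R.nrm_adG (R.H.inv_mem hh), len]

theorem len_expG {X : E} (hX : R.th X = -X) : R.len (expG G X) = R.nrm X := by
  rw [len, R.polarLog_expG hX]

theorem len_inv (g : G) : R.len g⁻¹ = R.len g := by
  obtain ⟨h, hh, hg⟩ := R.exists_eq_mul_expG_polarLog g
  conv_lhs => rw [hg]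
  rw [mul_inv_rev, R.len_mul_right _ (R.H.inv_mem hh), ← expG_neg,
    R.len_expG (by rw [map_neg, th_polarLog]), nrm_neg, len]

theorem point_eq_iff {a b : G} : R.point a = R.point b ↔ b * a⁻¹ ∈ R.H := by
  exact (Quotient.eq (r := QuotientGroup.rightRel R.H)).trans QuotientGroup.rightRel_apply

theorem point_mul {h : G} (hh : h ∈ R.H) (g : G) : R.point (h * g) = R.point g := by
  rw [point_eq_iff, mul_inv_rev, mul_inv_cancel_left]
  exact R.H.inv_mem hh

theorem exists_eq_point (x : R.SymSpace) : ∃ g : G, R.point g = x := Quotient.exists_rep x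

/-- The points `* a` and `* b` are joined by a curve of length `len (b * a⁻¹)`. -/
theorem exists_curve (a b : G) : ∃ c : ℝ → G, ContMDiff 𝓘(ℝ, ℝ) 𝓘(ℝ, E) 1 c ∧ c 0 = a ∧
    (∃ h ∈ R.H, c 1 = h * b) ∧ R.curveLength c = R.len (b * a⁻¹) := by
  obtain ⟨h, hh, hg⟩ := R.exists_eq_mul_expG_polarLog (b * a⁻¹)
  set X := R.polarLog (b * a⁻¹) with hX
  have : LieGroup 𝓘(ℝ, E) 1 G := LieGroup.of_le (n := ∞) (by simp)
  refine ⟨fun u => expG G (u • X) * a, (contMDiff_expG_smul X).mul contMDiff_const, by simp,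
    ⟨h⁻¹, R.H.inv_mem hh, ?_⟩, ?_⟩
  · rw [mul_inv_eq_iff_eq_mul] at hg
    simp only [one_smul]
    rw [hg]; group
  · rw [curveLength_expG, R.pr_eq_self (R.th_polarLog _), len]

theorem len_le_curveLength {c : ℝ → G} (hc : ContMDiff 𝓘(ℝ, ℝ) 𝓘(ℝ, E) 1 c) :
    R.len (c 1 * (c 0)⁻¹) ≤ R.curveLength c := by
  have : LieGroup 𝓘(ℝ, E) 1 G := LieGroup.of_le (n := ∞) (by simp)
  have h := R.nrm_polarLog_sub_le_curveLength (c := fun u => c u * (c 0)⁻¹)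
    (hc.mul contMDiff_const)
  rw [curveLength_mul_right] at h
  simpa [len] using h

/-- The distance of the symmetric space in terms of the polar projection. -/
theorem dist_point (a b : G) : dist (R.point a) (R.point b) = R.len (b * a⁻¹) := by
  refine le_antisymm (csInf_le ⟨0, ?_⟩ ?_) (le_csInf ?_ ?_)
  · rintro l ⟨c, -, -, -, rfl⟩; exact R.curveLength_nonneg c
  · obtain ⟨c, hc, h0, ⟨h, hh, h1⟩, hl⟩ := R.exists_curve a b
    exact ⟨c, hc, by rw [h0], by rw [h1, R.point_mul hh], hl.symm⟩
  · obtain ⟨c, hc, h0, ⟨h, hh, h1⟩, hl⟩ := R.exists_curve a b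
    exact ⟨_, c, hc, by rw [h0], by rw [h1, R.point_mul hh], rfl⟩
  · rintro l ⟨c, hc, h0, h1, rfl⟩
    rw [point_eq_iff] at h0 h1
    have h2 := R.len_le_curveLength hc
    have h3 : b * a⁻¹ = (b * (c 1)⁻¹) * ((c 1 * (c 0)⁻¹) * (a * (c 0)⁻¹)⁻¹) := by group
    rwa [h3, R.len_mul_left h1, R.len_mul_right _ (R.H.inv_mem h0)]

/-- The polar projection, seen as a map from the symmetric space to the Euclidean space `𝔪`, is
a contraction. -/
theorem nrm_polarLog_sub_le_dist (a b : G) :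
    R.nrm (R.polarLog a - R.polarLog b) ≤ dist (R.point a) (R.point b) := by
  obtain ⟨c, hc, h0, ⟨h, hh, h1⟩, hl⟩ := R.exists_curve a b
  have h2 := R.nrm_polarLog_sub_le_curveLength hc
  rwa [h0, h1, hl, R.polarLog_mul hh, nrm_sub_rev, ← dist_point] at h2

theorem dist_point_mul_right (a b g : G) :
    dist (R.point (a * g)) (R.point (b * g)) = dist (R.point a) (R.point b) := by
  rw [dist_point, dist_point]; congr 1; group

instance metricSpace : MetricSpace R.SymSpace where
  toDist := inferInstance
  dist_self x := by
    obtain ⟨a, rfl⟩ := R.exists_eq_point x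
    rw [dist_point, mul_inv_cancel, len, polarLog_one, nrm_zero]
  dist_comm x y := by
    obtain ⟨a, rfl⟩ := R.exists_eq_point x
    obtain ⟨b, rfl⟩ := R.exists_eq_point y
    rw [dist_point, dist_point, ← len_inv]; congr 1; group
  dist_triangle x y z := by
    obtain ⟨a, rfl⟩ := R.exists_eq_point x
    obtain ⟨b, rfl⟩ := R.exists_eq_point y
    obtain ⟨c, rfl⟩ := R.exists_eq_point z
    have h1 := R.nrm_polarLog_sub_le_dist (c * a⁻¹) (b * a⁻¹)
    rw [dist_point_mul_right] at h1
    have h2 := R.nrm_add_le (R.polarLog (b * a⁻¹)) (R.polarLog (c * a⁻¹) - R.polarLog (b * a⁻¹))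
    rw [add_sub_cancel] at h2
    have h3 : dist (R.point c) (R.point b) = dist (R.point b) (R.point c) := by
      rw [dist_point, dist_point, ← len_inv]; congr 1; group
    rw [R.dist_point a, R.dist_point a, len, len, ← h3]
    linarith
  eq_of_dist_eq_zero {x y} h := by
    obtain ⟨a, rfl⟩ := R.exists_eq_point x
    obtain ⟨b, rfl⟩ := R.exists_eq_point y
    rw [dist_point] at h
    exact R.point_eq_iff.2 (R.mem_H_of_polarLog_eq_zero (R.eq_zero_of_nrm_eq_zero h))

theorem dist_point_expG_smul_mul {X : E} (hX : R.th X = -X) (t u : ℝ) (a : G) :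
    dist (R.point (expG G (t • X) * a)) (R.point (expG G (u • X) * a)) = |t - u| * R.nrm X := by
  rw [dist_point_mul_right, dist_point, ← expG_neg, ← neg_smul, ← expG_add_smul, R.len_expG
    (by rw [map_smul, hX, smul_neg]), nrm_smul, ← sub_eq_add_neg, abs_sub_comm]

/-- The Bruhat–Tits inequality characterizing nonpositive curvature, along the geodesic
`l ↦ * exp (l X) a`. -/
theorem dist_sq_le {X : E} (hX : R.th X = -X) (a : G) (z : R.SymSpace) {l : ℝ}
    (hl : l ∈ Set.Icc (0 : ℝ) 1) :
    dist (R.point (expG G (l • X) * a)) z ^ 2 ≤ (1 - l) * dist (R.point a) z ^ 2 +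
      l * dist (R.point (expG G X * a)) z ^ 2 - l * (1 - l) * R.nrm X ^ 2 := by
  obtain ⟨b, rfl⟩ := R.exists_eq_point z
  set m := expG G (l • X) * a with hm
  set W := R.polarLog (b * m⁻¹) with hW
  have h1 := R.nrm_polarLog_sub_le_dist (a * m⁻¹) (b * m⁻¹)
  have h2 := R.nrm_polarLog_sub_le_dist (expG G X * a * m⁻¹) (b * m⁻¹)
  have e1 : a * m⁻¹ = expG G ((-l) • X) := by rw [hm, neg_smul, expG_neg]; group
  have e2 : expG G X * a * m⁻¹ = expG G ((1 - l) • X) := by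
    rw [mul_assoc, e1, sub_eq_add_neg, expG_add_smul, one_smul]
  have hsm (k : ℝ) : R.th (k • X) = -(k • X) := by rw [map_smul, hX, smul_neg]
  rw [dist_point_mul_right, ← hW] at h1 h2
  rw [e1, R.polarLog_expG (hsm _)] at h1
  rw [e2, R.polarLog_expG (hsm _)] at h2
  have h1' := pow_le_pow_left₀ (R.nrm_nonneg _) h1 2
  have h2' := pow_le_pow_left₀ (R.nrm_nonneg _) h2 2
  rw [nrm_sub_sq, nrm_smul, mul_pow, sq_abs, map_smul, LinearMap.smul_apply, smul_eq_mul]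
    at h1' h2'
  rw [R.dist_point m, len, ← hW]
  have h3 := mul_le_mul_of_nonneg_left h1' (sub_nonneg.2 hl.2)
  have h4 := mul_le_mul_of_nonneg_left h2' hl.1
  linarith

/-- Geodesics issuing from a common point diverge at least linearly. -/
theorem dist_smul_le {X Y : E} (hX : R.th X = -X) (hY : R.th Y = -Y) (a : G) {l : ℝ}
    (hl : l ∈ Set.Icc (0 : ℝ) 1) :
    dist (R.point (expG G (l • X) * a)) (R.point (expG G (l • Y) * a)) ≤
      l * dist (R.point (expG G X * a)) (R.point (expG G Y * a)) := by
  have h1 := R.dist_sq_le hX a (R.point (expG G (l • Y) * a)) hl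
  have h2 := R.dist_sq_le hY a (R.point (expG G X * a)) hl
  have e1 := R.dist_point_expG_smul_mul hX 0 1 a
  have e2 := R.dist_point_expG_smul_mul hY 0 l a
  simp only [zero_smul, expG_zero, one_mul, one_smul, zero_sub, abs_neg, abs_one,
    abs_of_nonneg hl.1] at e1 e2
  rw [e1] at h2
  rw [e2] at h1
  rw [dist_comm (R.point (expG G (l • Y) * a)), dist_comm (R.point (expG G Y * a))] at h2
  have h3 := mul_le_mul_of_nonneg_left h2 hl.1
  refine abs_le_of_sq_le_sq' ?_ (mul_nonneg hl.1 dist_nonneg) |>.2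
  linarith

/-! ### Openness of the polar projection and bounded subsets -/

/-- The polar projection `G → 𝔪` is open at `exp X`, because its differential maps `𝔪` onto `𝔪`. -/
theorem eventually_exists_polarLog_eq {X : E} (hX : R.th X = -X) {U : Set G}
    (hU : U ∈ 𝓝 (expG G X)) :
    ∀ᶠ Y in 𝓝[{Y | R.th Y = -Y}] X, ∃ g ∈ U, R.polarLog g = Y := by
  let V : Submodule ℝ E := LinearMap.eqLocus R.th (-LinearMap.id)
  have hV (Y : E) : Y ∈ V ↔ R.th Y = -Y := Iff.rfl
  let π : E →L[ℝ] V := (R.pr.codRestrict V fun Y => R.th_pr Y).toContinuousLinearMap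
  have hπ (Y : V) : π Y = Y := Subtype.ext (R.pr_eq_self Y.2)
  let f : G → E := fun x => R.polarLog (x * expG G X)
  let F : E → V := fun y => π (f ((chartOne E G).symm y))
  have hf : ContMDiffAt 𝓘(ℝ, E) 𝓘(ℝ, E) 1 f 1 := by
    have : LieGroup 𝓘(ℝ, E) 1 G := LieGroup.of_le (n := ∞) (by simp)
    exact ((R.contMDiff_polarLog.of_le (by simp)).comp
      (contMDiff_id.mul contMDiff_const)).contMDiffAt
  have hsymm : ContMDiffAt 𝓘(ℝ, E) 𝓘(ℝ, E) 1 (chartOne E G).symm (chartOne E G 1) :=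
    contMDiffAt_chartOne_symm.of_le (by simp)
  have hf' : ContDiffAt ℝ 1 (fun y => f ((chartOne E G).symm y)) (chartOne E G 1) := by
    rw [← contMDiffAt_iff_contDiffAt]
    refine ContMDiffAt.comp (g := f) _ ?_ hsymm
    rwa [chartOne_symm_chartOne_one]
  have hd : HasStrictFDerivAt (fun y => f ((chartOne E G).symm y)) (R.dLog (expG G X))
      (chartOne E G 1) := by
    have h1 := hf'.hasStrictFDerivAt (by simp)
    rwa [← diffAt_one_eq_fderiv (hf.mdifferentiableAt (by simp))] at h1
  have hF : HasStrictFDerivAt F (π.comp (R.dLog (expG G X))) (chartOne E G 1) :=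
    π.hasStrictFDerivAt.comp _ hd
  have hsurj : (π.comp (R.dLog (expG G X))).range = ⊤ := by
    let T : V →ₗ[ℝ] V := (π.comp (R.dLog (expG G X))).toLinearMap ∘ₗ V.subtype
    have hT : Function.Injective T := by
      rw [← LinearMap.ker_eq_bot, LinearMap.ker_eq_bot']
      intro Y hY
      have h1 : R.pr (R.dLog (expG G X) Y) = 0 := congrArg Subtype.val hY
      rw [R.pr_eq_self (R.th_dLog_expG hX)] at h1
      exact Subtype.ext (R.eq_zero_of_dLog_expG_eq_zero hX Y.2 h1)
    rw [LinearMap.range_eq_top]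
    intro Y
    obtain ⟨Z, hZ⟩ := LinearMap.surjective_of_injective hT Y
    exact ⟨Z, hZ⟩
  have hmap := hF.map_nhds_eq_of_surj hsurj
  have hFX : F (chartOne E G 1) = ⟨X, hX⟩ := by
    simp only [F, f, chartOne_symm_chartOne_one, one_mul, R.polarLog_expG hX]
    exact hπ ⟨X, hX⟩
  have hcont : ContinuousAt (fun y => (chartOne E G).symm y * expG G X) (chartOne E G 1) := by
    have : LieGroup 𝓘(ℝ, E) 1 G := LieGroup.of_le (n := ∞) (by simp)
    exact (hsymm.mul contMDiffAt_const).continuousAt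
  have hU' : (fun y => (chartOne E G).symm y * expG G X) ⁻¹' U ∈ 𝓝 (chartOne E G 1) :=
    hcont (by simpa only [chartOne_symm_chartOne_one, one_mul] using hU)
  have h1 := image_mem_map (m := F) hU'
  rw [hmap, hFX] at h1
  have h2 : (Subtype.val : V → E) ⁻¹' {Y | ∃ g ∈ U, R.polarLog g = Y} ∈ 𝓝 (⟨X, hX⟩ : V) := by
    filter_upwards [h1]
    rintro _ ⟨y, hy, rfl⟩
    exact ⟨_, hy, (R.pr_eq_self (R.th_polarLog _)).symm⟩
  exact preimage_coe_mem_nhds_subtype.1 h2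

theorem point_eq_of_polarLog_eq {a b : G} (h : R.polarLog a = R.polarLog b) :
    R.point a = R.point b := by
  obtain ⟨k, hk, hk'⟩ := R.exists_eq_mul_expG_polarLog a
  obtain ⟨l, hl, hl'⟩ := R.exists_eq_mul_expG_polarLog b
  rw [hk', hl', R.point_mul hk, R.point_mul hl, h]

/-- The map `X ↦ * exp X a` is continuous on `𝔪`: it is a section of the polar projection, which
is open. -/
theorem tendsto_point_expG {ι : Type*} {F : Filter ι} {Y : ι → E} {X : E}
    (hY : ∀ i, R.th (Y i) = -Y i) (hX : R.th X = -X) (h : Tendsto Y F (𝓝 X)) (a : G) :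
    Tendsto (fun i => R.point (expG G (Y i) * a)) F (𝓝 (R.point (expG G X * a))) := by
  rw [Metric.tendsto_nhds]
  intro ε hε
  have : LieGroup 𝓘(ℝ, E) 1 G := LieGroup.of_le (n := ∞) (by simp)
  have : IsTopologicalGroup G := topologicalGroup_of_lieGroup 𝓘(ℝ, E) 1
  have hU : {g : G | R.len (expG G X * g⁻¹) < ε} ∈ 𝓝 (expG G X) := by
    refine (isOpen_Iio.preimage (R.continuous_len.comp (by fun_prop : Continuous
      fun g : G => expG G X * g⁻¹))).mem_nhds ?_
    simpa [len] using hε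
  have h1 : Tendsto Y F (𝓝[{Y | R.th Y = -Y}] X) :=
    tendsto_nhdsWithin_iff.2 ⟨h, Eventually.of_forall hY⟩
  filter_upwards [h1.eventually (R.eventually_exists_polarLog_eq hX hU)] with i hi
  obtain ⟨g, hg, hg'⟩ := hi
  rw [dist_point_mul_right, ← R.point_eq_of_polarLog_eq (a := g)
    (by rw [hg', R.polarLog_expG (hY i)]), dist_point]
  exact hg

/-- The balls of the symmetric space are relatively compact. -/
theorem exists_isCompact_of_len_le (C : ℝ) :
    ∃ K : Set G, IsCompact K ∧ ∀ g, R.len g ≤ C → g ∈ K := by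
  have : LieGroup 𝓘(ℝ, E) 1 G := LieGroup.of_le (n := ∞) (by simp)
  have : IsTopologicalGroup G := topologicalGroup_of_lieGroup 𝓘(ℝ, E) 1
  have : LocallyCompactSpace G := Manifold.locallyCompact_of_finiteDimensional 𝓘(ℝ, E)
  set S : Set E := {X | R.th X = -X ∧ R.nrm X ≤ C} with hS
  have hSc : IsCompact S := by
    obtain ⟨M, hM⟩ := R.exists_norm_le_mul_nrm
    refine Metric.isCompact_of_isClosed_isBounded ?_ ?_
    · exact (isClosed_eq R.th.continuous_of_finiteDimensional continuous_neg).inter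
        (isClosed_le R.continuous_nrm continuous_const)
    · refine isBounded_iff_forall_norm_le.2 ⟨|M| * C, fun X hX => (hM X).trans ?_⟩
      exact mul_le_mul (le_abs_self M) hX.2 (R.nrm_nonneg X) (abs_nonneg M)
  choose K hKc hK using fun X : E => exists_compact_mem_nhds (expG G X)
  obtain ⟨T, -, hT⟩ := hSc.elim_nhdsWithin_subcover (fun X => {Y | ∃ g ∈ K X, R.polarLog g = Y})
    fun X hX => nhdsWithin_mono X (fun Y hY => hY.1)
      (R.eventually_exists_polarLog_eq hX.1 (hK X))
  refine ⟨(fun q : G × G => q.1 * q.2) '' ((R.H : Set G) ×ˢ ⋃ X ∈ T, K X),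
    (R.isCompact_H.prod (T.isCompact_biUnion fun X _ => hKc X)).image continuous_mul, ?_⟩
  intro g hg
  have h1 := hT (show R.polarLog g ∈ S from ⟨R.th_polarLog g, hg⟩)
  simp only [Set.mem_iUnion] at h1
  obtain ⟨X, hX, k, hk, hk'⟩ := h1
  refine ⟨(g * k⁻¹, k), ⟨R.point_eq_iff.1 (R.point_eq_of_polarLog_eq hk'), ?_⟩, by simp⟩
  simp only [Set.mem_iUnion]
  exact ⟨X, hX, hk⟩

/-- By compactness of the closed balls, `exp (t s) g exp (-t s)` is bounded if and only if the ray
`* exp (t s) g` stays at bounded distance of the ray `* exp (t s)`. -/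
theorem mem_P_iff {s : E} {g : G} : g ∈ P (E := E) (G := G) s ↔
    ∃ C : ℝ, ∀ t : ℝ, 0 ≤ t → R.len (expG G (t • s) * g * (expG G (t • s))⁻¹) ≤ C := by
  constructor
  · rintro ⟨K, hK, h⟩
    obtain ⟨C, hC⟩ := hK.bddAbove_image R.continuous_len.continuousOn
    exact ⟨C, fun t ht => hC ⟨_, h t ht, rfl⟩⟩
  · rintro ⟨C, hC⟩
    obtain ⟨K, hK, h⟩ := R.exists_isCompact_of_len_le C
    exact ⟨K, hK, fun t ht => h _ (hC t ht)⟩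

end RealReductiveGroup

/-! ### Angles between geodesic rays in nonpositive curvature -/

namespace MetricBoundary

variable {X : Type*} [MetricSpace X]

variable (X) in
/-- The Bruhat–Tits form of nonpositive curvature: any two points are joined by a geodesic along
which the squared distance to a third point is at least as convex as in the Euclidean plane. -/
def IsNonpositivelyCurved : Prop :=
  ∀ (x y : X) (l : ℝ), l ∈ Set.Icc (0 : ℝ) 1 → ∃ m : X, ∀ z : X,
    dist m z ^ 2 ≤ (1 - l) * dist x z ^ 2 + l * dist y z ^ 2 - l * (1 - l) * dist x y ^ 2

theorem IsGeodesicRay.dist_zero {c : ℝ≥0 → X} (hc : IsGeodesicRay c) (t : ℝ≥0) :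
    dist (c 0) (c t) = t := by
  rw [hc]; simp

/-- The curvature inequality along a geodesic ray, multiplied by `u`. -/
theorem IsGeodesicRay.mul_dist_sq_le (hX : IsNonpositivelyCurved X) {c : ℝ≥0 → X}
    (hc : IsGeodesicRay c) {t u : ℝ≥0} (htu : t ≤ u) (z : X) :
    u * dist (c t) z ^ 2 ≤
      (u - t) * dist (c 0) z ^ 2 + t * dist (c u) z ^ 2 - t * (u - t) * u := by
  obtain rfl | hu := eq_zero_or_pos u
  · obtain rfl := le_antisymm htu zero_le
    simp
  have hu' : (0 : ℝ) < u := hu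
  have htu' : (t : ℝ) ≤ u := htu
  obtain ⟨m, hm⟩ := hX (c 0) (c u) (t / u) ⟨by positivity, (div_le_one hu').2 htu'⟩
  -- the point given by the curvature condition lies on the ray
  have h1 : m = c t := by
    have h2 := hm (c t)
    rw [hc.dist_zero, hc.dist_zero, hc, abs_of_nonneg (sub_nonneg.2 htu')] at h2
    have h3 : (1 - (t : ℝ) / u) * t ^ 2 + t / u * (u - t) ^ 2 - t / u * (1 - t / u) * u ^ 2 = 0 := by
      field_simp; ring
    rw [h3] at h2
    exact dist_eq_zero.1 (by nlinarith [dist_nonneg (x := m) (y := c t)])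
  have h2 := mul_le_mul_of_nonneg_left (hm z) hu'.le
  rw [h1, hc.dist_zero] at h2
  refine h2.trans (le_of_eq ?_)
  field_simp

/-- The cosine of the Euclidean comparison angle between `c t` and `c' u`, for two rays issuing
from the same point. -/
def cosComp (c c' : ℝ≥0 → X) (t u : ℝ≥0) : ℝ :=
  (t ^ 2 + u ^ 2 - dist (c t) (c' u) ^ 2) / (2 * t * u)

theorem cosComp_comm (c c' : ℝ≥0 → X) (t u : ℝ≥0) : cosComp c c' t u = cosComp c' c u t := by
  rw [cosComp, cosComp, dist_comm]; congr 1 <;> ring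

theorem comparisonAngle_eq {c c' : ℝ≥0 → X} (hc : IsGeodesicRay c) (hc' : IsGeodesicRay c')
    (h0 : c 0 = c' 0) (t u : ℝ≥0) :
    comparisonAngle (c 0) (c t) (c' u) = Real.arccos (cosComp c c' t u) := by
  rw [comparisonAngle, hc.dist_zero, h0, hc'.dist_zero, cosComp]

/-- Comparison angles increase along a geodesic ray. -/
theorem cosComp_anti_left (hX : IsNonpositivelyCurved X) {c c' : ℝ≥0 → X} (hc : IsGeodesicRay c)
    (hc' : IsGeodesicRay c') (h0 : c 0 = c' 0) {t T u : ℝ≥0} (ht : 0 < t) (htT : t ≤ T)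
    (hu : 0 < u) : cosComp c c' T u ≤ cosComp c c' t u := by
  have h := hc.mul_dist_sq_le hX htT (c' u)
  rw [h0, hc'.dist_zero] at h
  have ht' : (0 : ℝ) < t := ht
  have hT' : (0 : ℝ) < T := ht.trans_le htT
  have hu' : (0 : ℝ) < u := hu
  rw [cosComp, cosComp, div_le_div_iff₀ (by positivity) (by positivity)]
  have h1 : (t : ℝ) * (T ^ 2 + u ^ 2 - dist (c T) (c' u) ^ 2) ≤
      T * (t ^ 2 + u ^ 2 - dist (c t) (c' u) ^ 2) := by linarith
  have h2 := mul_le_mul_of_nonneg_left h1 (by positivity : (0 : ℝ) ≤ 2 * u)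
  linarith

theorem cosComp_anti_right (hX : IsNonpositivelyCurved X) {c c' : ℝ≥0 → X} (hc : IsGeodesicRay c)
    (hc' : IsGeodesicRay c') (h0 : c 0 = c' 0) {t u U : ℝ≥0} (ht : 0 < t) (hu : 0 < u)
    (huU : u ≤ U) : cosComp c c' t U ≤ cosComp c c' t u := by
  rw [cosComp_comm, cosComp_comm c]
  exact cosComp_anti_left hX hc' hc h0.symm hu huU ht

theorem cosComp_self {c c' : ℝ≥0 → X} {t : ℝ≥0} (ht : 0 < t) :
    cosComp c c' t t = 1 - dist (c t) (c' t) ^ 2 / (2 * t ^ 2) := by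
  have ht' : (t : ℝ) ≠ 0 := (NNReal.coe_pos.2 ht).ne'
  rw [cosComp]; field_simp; ring

theorem dist_le_two_mul {c c' : ℝ≥0 → X} (hc : IsGeodesicRay c) (hc' : IsGeodesicRay c')
    (h0 : c 0 = c' 0) (t : ℝ≥0) : dist (c t) (c' t) ≤ 2 * t := by
  have h := dist_triangle_left (c t) (c' t) (c 0)
  rw [hc.dist_zero, h0, hc'.dist_zero] at h
  linarith

theorem exists_tendsto_cosComp_self (hX : IsNonpositivelyCurved X) {c c' : ℝ≥0 → X}
    (hc : IsGeodesicRay c) (hc' : IsGeodesicRay c') (h0 : c 0 = c' 0) :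
    ∃ L : ℝ, Tendsto (fun t => cosComp c c' t t) atTop (𝓝 L) ∧ L ∈ Set.Icc (-1 : ℝ) 1 := by
  have hanti : Antitone fun t : ℝ≥0 => cosComp c c' (max t 1) (max t 1) := by
    intro t u htu
    have h1 (v : ℝ≥0) : 0 < max v 1 := zero_lt_one.trans_le (le_max_right _ _)
    have h2 : max t 1 ≤ max u 1 := max_le_max_right 1 htu
    exact (cosComp_anti_left hX hc hc' h0 (h1 t) h2 (h1 u)).trans
      (cosComp_anti_right hX hc hc' h0 (h1 t) (h1 t) h2)
  have hev : (fun t => cosComp c c' t t) =ᶠ[atTop] fun t => cosComp c c' (max t 1) (max t 1) := by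
    filter_upwards [eventually_ge_atTop 1] with t ht
    rw [max_eq_left ht]
  have hlow (t : ℝ≥0) : (-1 : ℝ) ≤ cosComp c c' (max t 1) (max t 1) := by
    have h1 : 0 < max t 1 := zero_lt_one.trans_le (le_max_right _ _)
    have h2 := dist_le_two_mul hc hc' h0 (max t 1)
    have h1' : (0 : ℝ) < (max t 1 : ℝ≥0) := h1
    rw [cosComp_self h1, neg_le_sub_iff_le_add, div_le_iff₀ (by positivity)]
    · nlinarith [dist_nonneg (x := c (max t 1)) (y := c' (max t 1))]
  have hup (t : ℝ≥0) : cosComp c c' (max t 1) (max t 1) ≤ 1 := by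
    rw [cosComp_self (zero_lt_one.trans_le (le_max_right _ _)), sub_le_self_iff]
    positivity
  have h := tendsto_atTop_ciInf hanti ⟨-1, by rintro _ ⟨t, rfl⟩; exact hlow t⟩
  exact ⟨_, h.congr' hev.symm, ge_of_tendsto' h hlow, le_of_tendsto' h hup⟩

/-- The limit of the comparison angles along two rays depends only on the points at infinity. -/
theorem tendsto_cosComp_self_of_asymptotic {c c' e e' : ℝ≥0 → X}
    (hc : IsGeodesicRay c) (hc' : IsGeodesicRay c') (h0 : c 0 = c' 0)
    (he : IsGeodesicRay e) (he' : IsGeodesicRay e') (h0' : e 0 = e' 0)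
    (h : Asymptotic e c) (h' : Asymptotic e' c') {L : ℝ}
    (hL : Tendsto (fun t => cosComp c c' t t) atTop (𝓝 L)) :
    Tendsto (fun t => cosComp e e' t t) atTop (𝓝 L) := by
  obtain ⟨C, hC⟩ := h
  obtain ⟨C', hC'⟩ := h'
  have hz : Tendsto (fun t : ℝ≥0 => 2 * (C + C') / (t : ℝ)) atTop (𝓝 0) :=
    Tendsto.const_div_atTop (NNReal.tendsto_coe_atTop.2 tendsto_id) _
  refine tendsto_of_tendsto_of_dist hL (squeeze_zero' (Eventually.of_forall fun _ => dist_nonneg)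
    ?_ hz)
  filter_upwards [eventually_gt_atTop 0] with t ht
  have ht' : (0 : ℝ) < t := ht
  set d := dist (c t) (c' t) with hd
  set d' := dist (e t) (e' t) with hd'
  have h1 : |d' - d| ≤ C + C' := by
    rw [hd, hd', ← Real.dist_eq]
    exact (dist_dist_dist_le _ _ _ _).trans (add_le_add (hC t) (hC' t))
  have h2 : d ≤ 2 * t := dist_le_two_mul hc hc' h0 t
  have h3 : d' ≤ 2 * t := dist_le_two_mul he he' h0' t
  have h4 : 0 ≤ d := dist_nonneg
  have h5 : 0 ≤ d' := dist_nonneg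
  have h6 : cosComp c c' t t - cosComp e e' t t = (d' - d) * (d' + d) / (2 * t ^ 2) := by
    rw [cosComp_self ht, cosComp_self ht, ← hd, ← hd']; ring
  rw [Real.dist_eq, h6, abs_div, abs_mul, abs_of_pos (show (0 : ℝ) < 2 * t ^ 2 by positivity),
    abs_of_nonneg (add_nonneg h5 h4), div_le_div_iff₀ (by positivity) ht']
  have h7 : |d' - d| * (d' + d) ≤ (C + C') * (4 * t) :=
    mul_le_mul h1 (by linarith) (by positivity) ((abs_nonneg _).trans h1)
  nlinarith

/-- All the comparison angles of two rays are at most the limit one. -/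
theorem le_cosComp (hX : IsNonpositivelyCurved X) {e e' : ℝ≥0 → X}
    (he : IsGeodesicRay e) (he' : IsGeodesicRay e') (h0 : e 0 = e' 0) {L : ℝ}
    (hL : Tendsto (fun t => cosComp e e' t t) atTop (𝓝 L)) {t u : ℝ≥0} (ht : 0 < t) (hu : 0 < u) :
    L ≤ cosComp e e' t u := by
  refine le_of_tendsto hL ?_
  filter_upwards [eventually_ge_atTop (max t u)] with T hT
  have h1 : t ≤ T := (le_max_left _ _).trans hT
  have h2 : u ≤ T := (le_max_right _ _).trans hT
  exact (cosComp_anti_left hX he he' h0 ht h1 (hu.trans_le h2)).trans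
    (cosComp_anti_right hX he he' h0 ht hu h2)

theorem angle_le_of_le_cosComp {e e' : ℝ≥0 → X}
    (he : IsGeodesicRay e) (he' : IsGeodesicRay e') (h0 : e 0 = e' 0) {a : ℝ}
    (ha : ∀ t u : ℝ≥0, 0 < t → 0 < u → a ≤ cosComp e e' t u) : angle e e' ≤ Real.arccos a := by
  refine limsup_le_of_le ?_ ?_
  · exact isCoboundedUnder_le_of_le _ (x := 0) fun _ => Real.arccos_nonneg _
  · filter_upwards [prod_mem_prod self_mem_nhdsWithin self_mem_nhdsWithin] with p hp
    rw [comparisonAngle_eq he he' h0]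
    exact Real.arccos_le_arccos (ha _ _ hp.1 hp.2)

theorem le_angle_of_cosComp_le {e e' : ℝ≥0 → X}
    (he : IsGeodesicRay e) (he' : IsGeodesicRay e') (h0 : e 0 = e' 0) {a : ℝ}
    (ha : ∀ t u : ℝ≥0, 0 < t → 0 < u → cosComp e e' t u ≤ a) : Real.arccos a ≤ angle e e' := by
  refine le_limsup_of_frequently_le (Eventually.frequently ?_)
    (isBoundedUnder_of ⟨Real.pi, fun _ => Real.arccos_le_pi _⟩)
  filter_upwards [prod_mem_prod self_mem_nhdsWithin self_mem_nhdsWithin] with p hp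
  rw [comparisonAngle_eq he he' h0]
  exact Real.arccos_le_arccos (ha _ _ hp.1 hp.2)

/-- If the comparison angles along two rays with a common origin converge to `arccos L`, and if
the boundary points can be seen, from suitable points, under comparison angles at least `arccos a`
with `a` arbitrarily close to `L`, then `L` is the cosine of the Tits angle. -/
theorem cos_titsAngle_eq (hX : IsNonpositivelyCurved X) {c c' : ℝ≥0 → X}
    (hc : IsGeodesicRay c) (hc' : IsGeodesicRay c') (h0 : c 0 = c' 0) {L : ℝ}
    (hL : Tendsto (fun t => cosComp c c' t t) atTop (𝓝 L)) {ι : Type*} {F : Filter ι} [F.NeBot]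
    {a : ι → ℝ} (ha : Tendsto a F (𝓝 L))
    (h : ∀ᶠ i in F, ∃ e ∈ endpoint c, ∃ e' ∈ endpoint c', e 0 = e' 0 ∧
      ∀ t u : ℝ≥0, 0 < t → 0 < u → cosComp e e' t u ≤ a i) :
    Real.cos (titsAngle (endpoint c) (endpoint c')) = L := by
  obtain ⟨L', hL', hL1⟩ := exists_tendsto_cosComp_self hX hc hc' h0
  obtain rfl := tendsto_nhds_unique hL hL'
  have hup : ∀ b ∈ {b : ℝ | ∃ e ∈ endpoint c, ∃ e' ∈ endpoint c', e 0 = e' 0 ∧ b = angle e e'},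
      b ≤ Real.arccos L := by
    rintro _ ⟨e, he, e', he', h0', rfl⟩
    have h1 := tendsto_cosComp_self_of_asymptotic hc hc' h0 he.1 he'.1 h0' he.2 he'.2 hL
    exact angle_le_of_le_cosComp he.1 he'.1 h0' fun t u ht hu =>
      le_cosComp hX he.1 he'.1 h0' h1 ht hu
  have heq : titsAngle (endpoint c) (endpoint c') = Real.arccos L := by
    refine le_antisymm (csSup_le ?_ hup) ?_
    · obtain ⟨i, e, he, e', he', h0', -⟩ := h.exists
      exact ⟨_, e, he, e', he', h0', rfl⟩
    · have h1 : Tendsto (fun i => Real.arccos (a i)) F (𝓝 (Real.arccos L)) :=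
        (Real.continuous_arccos.tendsto L).comp ha
      refine le_of_tendsto h1 (h.mono ?_)
      rintro i ⟨e, he, e', he', h0', h2⟩
      exact (le_angle_of_cosComp_le he.1 he'.1 h0' h2).trans
        (le_csSup ⟨_, hup⟩ ⟨e, he, e', he', h0', rfl⟩)
  rw [heq, Real.cos_arccos hL1.1 hL1.2]

end MetricBoundary

/-! ### The boundary at infinity of the symmetric space -/

namespace RealReductiveGroup

open MetricBoundary

variable {E : Type*} [NormedAddCommGroup E] [NormedSpace ℝ E] [FiniteDimensional ℝ E]
  {G : Type*} [TopologicalSpace G] [ChartedSpace E G] [Group G] [LieGroup 𝓘(ℝ, E) ∞ G] [T2Space G]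
  (R : RealReductiveGroup E G)

theorem isNonpositivelyCurved : IsNonpositivelyCurved R.SymSpace := by
  intro x y l hl
  obtain ⟨a, rfl⟩ := R.exists_eq_point x
  obtain ⟨b, rfl⟩ := R.exists_eq_point y
  obtain ⟨h, hh, hg⟩ := R.exists_eq_mul_expG_polarLog (b * a⁻¹)
  have hb : R.point (expG G (R.polarLog (b * a⁻¹)) * a) = R.point b := by
    rw [mul_inv_eq_iff_eq_mul, mul_assoc] at hg
    conv_rhs => rw [hg, R.point_mul hh]
  refine ⟨R.point (expG G (l • R.polarLog (b * a⁻¹)) * a), fun z => ?_⟩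
  have h1 := R.dist_sq_le (R.th_polarLog (b * a⁻¹)) a z hl
  rw [hb] at h1
  rw [R.dist_point a b, len]
  exact h1

/-- The curve `t ↦ * exp (t X) a`. -/
def ray (X : E) (a : G) (t : ℝ≥0) : R.SymSpace := R.point (expG G ((t : ℝ) • X) * a)

theorem ray_zero (X : E) (a : G) : R.ray X a 0 = R.point a := by simp [ray]

theorem isGeodesicRay_ray {X : E} (hX : R.th X = -X) (hX1 : R.nrm X = 1) (a : G) :
    IsGeodesicRay (R.ray X a) := fun t u => by
  rw [ray, ray, R.dist_point_expG_smul_mul hX, hX1, mul_one]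

theorem asymptotic_ray_self {X : E} (hX : R.th X = -X) (t : ℝ) :
    Asymptotic (R.ray X (expG G (t • X))) (R.ray X 1) := by
  refine ⟨|t| * R.nrm X, fun u => ?_⟩
  rw [ray, ray, ← expG_add_smul, mul_one]
  have h := R.dist_point_expG_smul_mul hX ((u : ℝ) + t) u 1
  rw [mul_one, mul_one, add_sub_cancel_left] at h
  exact h.le

/-- The elements of `P s` fix the point at infinity of the ray generated by `s`. -/
theorem asymptotic_ray_of_mem_P {s : E} {p : G} (hp : p ∈ P (E := E) (G := G) s) :
    Asymptotic (R.ray s p⁻¹) (R.ray s 1) := by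
  obtain ⟨C, hC⟩ := R.mem_P_iff.1 hp
  refine ⟨C, fun u => ?_⟩
  rw [ray, ray, dist_point]
  refine (le_of_eq ?_).trans (hC u u.2)
  congr 1; group

theorem ray_adG {s : E} {h : G} (hh : h ∈ R.H) (a : G) :
    R.ray (adG E h⁻¹ s) a = R.ray s (h * a) := by
  ext1 t
  rw [ray, ray, ← map_smul, ← conj_expG, inv_inv, mul_assoc, mul_assoc,
    R.point_mul (R.H.inv_mem hh)]

theorem polarLog_expG_mul {X : E} (hX : R.th X = -X) {h : G} (hh : h ∈ R.H) :
    R.polarLog (expG G X * h) = adG E h⁻¹ X := by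
  rw [R.polarLog_mul_right _ hh, R.polarLog_expG hX]

theorem th_smul {X : E} (hX : R.th X = -X) (t : ℝ) : R.th (t • X) = -(t • X) := by
  rw [map_smul, hX, smul_neg]

/-- Write `exp (r s) g = h exp X` with `h ∈ H` and `X ∈ 𝔪`. Then `X / r` is close to
`Ad (h⁻¹) s`, and the geodesic from `* g⁻¹` to `* exp (r s)`, whose direction is `X`, stays close
to the one from `*` to `* exp (r s)`. -/
theorem exists_approx {s : E} (hs : R.th s = -s) (g : G) {r : ℝ} (hr : 0 < r) :
    ∃ h ∈ R.H, ∃ Y : E, R.th Y = -Y ∧ R.nrm (Y - adG E h⁻¹ s) ≤ R.len g / r ∧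
      ∀ u ∈ Set.Icc 0 r, dist (R.point (expG G (u • Y) * g⁻¹)) (R.point (expG G (u • s))) ≤
        R.len g := by
  obtain ⟨h, hh, hg⟩ := R.exists_eq_mul_expG_polarLog (expG G (r • s) * g)
  set X := R.polarLog (expG G (r • s) * g) with hXdef
  have hX : R.th X = -X := R.th_polarLog _
  have hXn : R.th (-X) = -(-X) := by rw [map_neg, hX]
  set s' := adG E h⁻¹ s with hs'
  have hs'm : R.th s' = -s' := R.th_adG_of_th_eq_neg (R.H.inv_mem hh) hs
  have e1 : expG G (r • s) = h * expG G (r • s') * h⁻¹ := by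
    rw [hs', ← map_smul, ← conj_expG]; group
  have e2 : expG G (-X) = g⁻¹ * (expG G (r • s))⁻¹ * h := by
    rw [expG_neg, eq_comm, ← inv_inj, inv_inv, mul_inv_rev, mul_inv_rev, inv_inv, inv_inv, hg]
    group
  have hC : dist (R.point g⁻¹) (R.point 1) = R.len g := by
    rw [dist_point, inv_inv, one_mul]
  refine ⟨h, hh, r⁻¹ • X, R.th_smul hX _, ?_, fun u hu => ?_⟩
  · have h1 := R.nrm_polarLog_sub_le_dist (expG G (-X)) (expG G (-(r • s)) * h)
    rw [R.polarLog_expG hXn, R.polarLog_expG_mul (by rw [map_neg, R.th_smul hs]) hh] at h1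
    have h2 : dist (R.point (expG G (-X))) (R.point (expG G (-(r • s)) * h)) = R.len g := by
      rw [e2, mul_assoc, expG_neg, ← hC, ← R.dist_point_mul_right g⁻¹ 1 ((expG G (r • s))⁻¹ * h),
        one_mul]
    have h3 : -X - adG E h⁻¹ (-(r • s)) = (-r) • (r⁻¹ • X - s') := by
      rw [map_neg, map_smul, smul_sub, smul_smul, ← hs', neg_mul, mul_inv_cancel₀ hr.ne']
      module
    rw [h2, h3, nrm_smul, abs_neg, abs_of_pos hr] at h1
    rwa [le_div_iff₀ hr, mul_comm]
  · -- both geodesics are followed backwards from their common endpoint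
    set a := expG G X * g⁻¹ with ha
    have hl : 1 - u / r ∈ Set.Icc (0 : ℝ) 1 :=
      ⟨sub_nonneg.2 ((div_le_one hr).2 hu.2), sub_le_self _ (div_nonneg hu.1 hr.le)⟩
    have h1 := R.dist_smul_le hXn (R.th_smul hs'm (-r)) a hl
    have e3 : expG G ((1 - u / r) • -X) * a = expG G (u • r⁻¹ • X) * g⁻¹ := by
      have : (1 - u / r) • -X = (u / r + -1) • X := by module
      rw [this, expG_add_smul, neg_smul, one_smul, expG_neg, ha, mul_assoc, inv_mul_cancel_left,
        smul_smul, div_eq_mul_inv]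
    have e4 : a = h⁻¹ * expG G (r • s) := by
      rw [ha]
      have : expG G X = h⁻¹ * (expG G (r • s) * g) := by rw [hg]; group
      rw [this]; group
    have e5 (v : ℝ) : R.point (expG G (v • s') * a) = R.point (expG G ((v + r) • s)) := by
      rw [e4, hs', ← map_smul, ← conj_expG, expG_add_smul, inv_inv]
      have : h⁻¹ * expG G (v • s) * h * (h⁻¹ * expG G (r • s)) =
        h⁻¹ * (expG G (v • s) * expG G (r • s)) := by group
      rw [this, R.point_mul (R.H.inv_mem hh)]
    have e6 : (1 - u / r) * -r + r = u := by field_simp; ring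
    have e7 : expG G (-X) * a = g⁻¹ := by rw [ha, expG_neg]; group
    rw [e3, e7, smul_smul (1 - u / r), e5, e5, e6, neg_add_cancel, zero_smul, expG_zero, hC] at h1
    exact h1.trans (mul_le_of_le_one_left (R.len_nonneg g) hl.2)

/-- The group is the product of `P s` and `H`. -/
theorem exists_mem_P {s : E} (hs : R.th s = -s) (g : G) :
    ∃ h ∈ R.H, ∃ p ∈ P (E := E) (G := G) s, g = p * h := by
  choose h hh Y hY hYs hd using fun n : ℕ => R.exists_approx hs g (Nat.cast_add_one_pos (α := ℝ) n)
  obtain ⟨k, hk, hlim⟩ := R.isCompact_H.ultrafilter_le_nhds ((hyperfilter ℕ).map h)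
    (by
      rw [Ultrafilter.coe_map, le_principal_iff, mem_map]
      exact univ_mem' hh)
  have hlim : Tendsto h (hyperfilter ℕ) (𝓝 k) := hlim
  have : LieGroup 𝓘(ℝ, E) 1 G := LieGroup.of_le (n := ∞) (by simp)
  have : IsTopologicalGroup G := topologicalGroup_of_lieGroup 𝓘(ℝ, E) 1
  have hs' : R.th (adG E k⁻¹ s) = -adG E k⁻¹ s := R.th_adG_of_th_eq_neg (R.H.inv_mem hk) hs
  have h1 : Tendsto (fun n => adG E (h n)⁻¹ s) (hyperfilter ℕ) (𝓝 (adG E k⁻¹ s)) := by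
    have h2 : Tendsto (fun n => adG E (h n)⁻¹) (hyperfilter ℕ) (𝓝 (adG E k⁻¹)) :=
      (contMDiffAt_adG k⁻¹).continuousAt.tendsto.comp hlim.inv
    exact ((ContinuousLinearMap.apply ℝ E s).continuous.tendsto _).comp h2
  have h2 : Tendsto (fun n => Y n - adG E (h n)⁻¹ s) (hyperfilter ℕ) (𝓝 0) := by
    obtain ⟨M, hM⟩ := R.exists_norm_le_mul_nrm
    have h3 : Tendsto (fun n : ℕ => |M| * (R.len g / ((n : ℝ) + 1))) atTop (𝓝 0) := by
      have h4 := (tendsto_const_nhds (x := R.len g)).div_atTop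
        (tendsto_natCast_atTop_atTop (R := ℝ).atTop_add tendsto_const_nhds (C := (1 : ℝ)))
      simpa using h4.const_mul |M|
    refine squeeze_zero_norm (fun n => (hM _).trans ?_) (h3.mono_left Nat.hyperfilter_le_atTop)
    exact mul_le_mul (le_abs_self M) (hYs n) (R.nrm_nonneg _) (abs_nonneg M)
  have h3 : Tendsto Y (hyperfilter ℕ) (𝓝 (adG E k⁻¹ s)) := by
    simpa using h2.add h1
  refine ⟨k, hk, g * k⁻¹, R.mem_P_iff.2 ⟨R.len g, fun u hu => ?_⟩, by group⟩
  have h4 := R.tendsto_point_expG (fun n => R.th_smul (hY n) u) (R.th_smul hs' u)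
    (h3.const_smul u) g⁻¹
  have h5 : dist (R.point (expG G (u • adG E k⁻¹ s) * g⁻¹)) (R.point (expG G (u • s))) ≤
      R.len g := by
    refine le_of_tendsto (h4.dist tendsto_const_nhds) ?_
    have h6 : ∀ᶠ n : ℕ in atTop, u ≤ n + 1 :=
      (tendsto_natCast_atTop_atTop.eventually_ge_atTop u).mono fun n hn => by linarith
    filter_upwards [h6.filter_mono Nat.hyperfilter_le_atTop] with n hn
    exact hd n u ⟨hu, hn⟩
  rw [← map_smul, ← conj_expG, inv_inv, mul_assoc, mul_assoc, R.point_mul (R.H.inv_mem hk),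
    dist_point] at h5
  refine (le_of_eq ?_).trans h5
  congr 1; group

theorem exists_act_eq {s : E} (hs : R.th s = -s) (g : G) :
    ∃ h ∈ R.H, ∃ p ∈ P (E := E) (G := G) s, g = p * h ∧ R.act s g = adG E h⁻¹ s := by
  have hd := R.exists_mem_P hs g
  obtain ⟨h1, p, hp, h2⟩ := hd.choose_spec
  exact ⟨_, h1, p, hp, h2, dif_pos hd⟩

/-- The pairing `⟨s · exp (-t σ), σ⟩`, whose limit is `μ_s(σ)`. -/
def pairing (s σ : E) (t : ℝ) : ℝ := R.bil (R.act s (expG G (-(t • σ)))) σ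

/-- The points at infinity `η(σ)` and `η(s)` are seen from `* exp (t σ)` under comparison angles
at least the arc cosine of the pairing: the polar projection centred at this point is a
contraction. -/
theorem exists_endpoint_cosComp_le {s σ : E} (hs : R.th s = -s) (hσ : R.th σ = -σ)
    (hs1 : R.nrm s = 1) (hσ1 : R.nrm σ = 1) (t : ℝ) :
    ∃ e ∈ endpoint (R.ray σ 1), ∃ e' ∈ endpoint (R.ray s 1), e 0 = e' 0 ∧
      ∀ u v : ℝ≥0, 0 < u → 0 < v → cosComp e e' u v ≤ R.pairing s σ t := by
  obtain ⟨h, hh, p, hp, hg, hact⟩ := R.exists_act_eq hs (expG G (-(t • σ)))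
  have hs'm := R.th_adG_of_th_eq_neg (R.H.inv_mem hh) hs
  have hs'1 : R.nrm (adG E h⁻¹ s) = 1 := by rw [R.nrm_adG (R.H.inv_mem hh), hs1]
  have hp' : h * expG G (t • σ) = p⁻¹ := by
    rw [expG_neg, inv_eq_iff_eq_inv] at hg
    rw [hg]; group
  refine ⟨R.ray σ (expG G (t • σ)), ⟨R.isGeodesicRay_ray hσ hσ1 _, R.asymptotic_ray_self hσ t⟩,
    R.ray (adG E h⁻¹ s) (expG G (t • σ)), ⟨R.isGeodesicRay_ray hs'm hs'1 _, ?_⟩,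
    by rw [ray_zero, ray_zero], fun u v hu hv => ?_⟩
  · rw [R.ray_adG hh, hp']
    exact R.asymptotic_ray_of_mem_P hp
  · have hu' : (0 : ℝ) < u := hu
    have hv' : (0 : ℝ) < v := hv
    have h1 := R.nrm_polarLog_sub_le_dist (expG G ((u : ℝ) • σ)) (expG G ((v : ℝ) • adG E h⁻¹ s))
    rw [R.polarLog_expG (R.th_smul hσ _), R.polarLog_expG (R.th_smul hs'm _),
      ← R.dist_point_mul_right _ _ (expG G (t • σ))] at h1
    have h2 := pow_le_pow_left₀ (R.nrm_nonneg _) h1 2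
    rw [nrm_sub_sq, nrm_smul, nrm_smul, hσ1, hs'1, abs_of_pos hu', abs_of_pos hv', map_smul,
      map_smul, LinearMap.smul_apply, smul_eq_mul, smul_eq_mul] at h2
    have h3 : R.pairing s σ t = R.ip σ (adG E h⁻¹ s) := by
      rw [pairing, hact, ← R.ip_eq_bil hs'm, ip_symm]
    rw [cosComp, h3, div_le_iff₀ (by positivity)]
    simp only [ray]
    linarith

/-- The pairing at time `t` is at most the cosine of the comparison angle at `*` of the points
`* exp (t σ)` and `* exp (t s)`. -/
theorem pairing_le_cosComp {s σ : E} (hs : R.th s = -s) (hσ : R.th σ = -σ)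
    (hs1 : R.nrm s = 1) (hσ1 : R.nrm σ = 1) {t : ℝ≥0} (ht : 0 < t) :
    R.pairing s σ t ≤ cosComp (R.ray σ 1) (R.ray s 1) t t := by
  obtain ⟨h, hh, p, hp, hg, hact⟩ := R.exists_act_eq hs (expG G (-((t : ℝ) • σ)))
  have hs'm := R.th_adG_of_th_eq_neg (R.H.inv_mem hh) hs
  have h3 : R.pairing s σ t = R.ip σ (adG E h⁻¹ s) := by
    rw [pairing, hact, ← R.ip_eq_bil hs'm, ip_symm]
  have ht' : (0 : ℝ) < t := ht
  obtain ⟨C, hC⟩ := R.mem_P_iff.1 hp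
  -- The polar projection at `*` contracts the triangle `* exp (-t σ)`, `*`,
  -- `* exp (u s) exp (-t σ)`; the projection of its last vertex is within `C` of
  -- `u (s · exp (-t σ))`.
  have key (u : ℝ≥0) (hu : t ≤ u) :
      R.pairing s σ t + (t - C) / u ≤ cosComp (R.ray σ 1) (R.ray s 1) t t := by
    have hu0 : 0 < u := ht.trans_le hu
    have hu' : (0 : ℝ) < u := hu0
    refine le_trans ?_ (cosComp_anti_right R.isNonpositivelyCurved (R.isGeodesicRay_ray hσ hσ1 1)
      (R.isGeodesicRay_ray hs hs1 1) (by rw [ray_zero, ray_zero]) ht ht hu)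
    set Z := R.polarLog (expG G ((u : ℝ) • s) * expG G (-((t : ℝ) • σ))) with hZ
    have hZd : dist (R.ray σ 1 t) (R.ray s 1 u) = R.nrm Z := by
      rw [ray, ray, mul_one, mul_one, dist_point, ← expG_neg, len]
    have h4 : R.nrm (Z - (u : ℝ) • adG E h⁻¹ s) ≤ C := by
      have h5 := R.nrm_polarLog_sub_le_dist (expG G ((u : ℝ) • s) * expG G (-((t : ℝ) • σ)))
        (expG G ((u : ℝ) • s) * h)
      rw [R.polarLog_expG_mul (R.th_smul hs _) hh, map_smul, dist_point, ← len_inv] at h5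
      refine (h5.trans (le_of_eq ?_)).trans (hC u hu'.le)
      rw [hg]; congr 1; group
    have h6 : R.nrm (Z + (t : ℝ) • σ) ≤ u := by
      have h7 := R.nrm_polarLog_sub_le_dist (expG G ((u : ℝ) • s) * expG G (-((t : ℝ) • σ)))
        (expG G (-((t : ℝ) • σ)))
      have h8 := R.dist_point_mul_right (expG G ((u : ℝ) • s)) 1 (expG G (-((t : ℝ) • σ)))
      rw [one_mul] at h8
      rw [h8, dist_point, one_mul, len_inv, R.len_expG (R.th_smul hs _), nrm_smul, hs1, mul_one,
        abs_of_pos hu', R.polarLog_expG (by rw [map_neg, R.th_smul hσ]), sub_neg_eq_add] at h7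
      exact h7
    have h9 := pow_le_pow_left₀ (R.nrm_nonneg _) h6 2
    rw [nrm_add_sq, nrm_smul, hσ1, mul_one, abs_of_pos ht', map_smul, smul_eq_mul] at h9
    have h10 : (u : ℝ) * R.pairing s σ t - C ≤ R.ip Z σ := by
      have h11 := (R.abs_ip_le (Z - (u : ℝ) • adG E h⁻¹ s) σ).trans
        (mul_le_mul_of_nonneg_right h4 (R.nrm_nonneg σ))
      rw [hσ1, mul_one, map_sub, LinearMap.sub_apply, map_smul, LinearMap.smul_apply, smul_eq_mul,
        R.ip_symm _ σ, R.ip_symm _ σ, ← h3, R.ip_symm σ] at h11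
      linarith [(abs_le.1 h11).1]
    rw [cosComp, hZd, le_div_iff₀ (by positivity)]
    have h12 : (R.pairing s σ t + (t - C) / u) * (2 * t * u) =
        2 * t * (u * R.pairing s σ t + (t - C)) := by field_simp
    rw [h12]
    nlinarith [mul_le_mul_of_nonneg_left h10 ht'.le]
  have hlim : Tendsto (fun u : ℝ≥0 => R.pairing s σ t + (t - C) / (u : ℝ)) atTop
      (𝓝 (R.pairing s σ t + 0)) :=
    tendsto_const_nhds.add
      (Tendsto.const_div_atTop (NNReal.tendsto_coe_atTop.2 tendsto_id) _)
  rw [add_zero] at hlim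
  exact le_of_tendsto hlim ((eventually_ge_atTop t).mono key)

theorem tendsto_pairing {s σ : E} (hs : R.th s = -s) (hσ : R.th σ = -σ)
    (hs1 : R.nrm s = 1) (hσ1 : R.nrm σ = 1) {L : ℝ}
    (hL : Tendsto (fun t => cosComp (R.ray σ 1) (R.ray s 1) t t) atTop (𝓝 L)) :
    Tendsto (R.pairing s σ) atTop (𝓝 L) := by
  have hc := R.isGeodesicRay_ray hσ hσ1 1
  have hc' := R.isGeodesicRay_ray hs hs1 1
  have h0 : R.ray σ 1 0 = R.ray s 1 0 := by rw [ray_zero, ray_zero]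
  refine tendsto_of_tendsto_of_tendsto_of_le_of_le' tendsto_const_nhds
    (hL.comp Real.tendsto_toNNReal_atTop) (Eventually.of_forall fun t => ?_) ?_
  · obtain ⟨e, he, e', he', h0', h⟩ := R.exists_endpoint_cosComp_le hs hσ hs1 hσ1 t
    exact (le_cosComp R.isNonpositivelyCurved he.1 he'.1 h0'
      (tendsto_cosComp_self_of_asymptotic hc hc' h0 he.1 he'.1 h0' he.2 he'.2 hL)
      one_pos one_pos).trans (h 1 1 one_pos one_pos)
  · filter_upwards [eventually_gt_atTop 0] with t ht
    have h := R.pairing_le_cosComp hs hσ hs1 hσ1 (Real.toNNReal_pos.2 ht)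
    rwa [Real.coe_toNNReal t ht.le] at h

theorem eta_eq (s : E) : R.eta s = endpoint (R.ray s 1) := by
  have h : R.ray s 1 = fun t : ℝ≥0 => R.point (expG G ((t : ℝ) • s)) := by
    ext1 t; rw [ray, mul_one]
  rw [h]; rfl

theorem eta_mem_visualBoundary {s : E} (hs : R.th s = -s) (hs1 : R.nrm s = 1) :
    R.eta s ∈ visualBoundary R.SymSpace :=
  ⟨_, R.isGeodesicRay_ray hs hs1 1, R.eta_eq s⟩

/-- The theorem for unit vectors of `𝔪`, with the Lie algebra written as the model space. -/
theorem tendsto_pairing_and_mu_eq {s σ : E} (hs : R.th s = -s) (hσ : R.th σ = -σ)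
    (hs1 : R.nrm s = 1) (hσ1 : R.nrm σ = 1) :
    R.eta s ∈ visualBoundary R.SymSpace ∧ R.eta σ ∈ visualBoundary R.SymSpace ∧
    Tendsto (R.pairing s σ) atTop (𝓝 (R.mu s σ)) ∧
    R.mu s σ = Real.cos (titsAngle (R.eta σ) (R.eta s)) ∧ R.mu σ s = R.mu s σ := by
  have hc := R.isGeodesicRay_ray hσ hσ1 1
  have hc' := R.isGeodesicRay_ray hs hs1 1
  have h0 : R.ray σ 1 0 = R.ray s 1 0 := by rw [ray_zero, ray_zero]
  obtain ⟨L, hL, -⟩ :=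
    exists_tendsto_cosComp_self R.isNonpositivelyCurved hc hc' h0
  have hL' : Tendsto (fun t => cosComp (R.ray s 1) (R.ray σ 1) t t) atTop (𝓝 L) := by
    simpa only [cosComp_comm (R.ray s 1)] using hL
  have h1 := R.tendsto_pairing hs hσ hs1 hσ1 hL
  have h2 : R.mu s σ = L := h1.limUnder_eq
  have h3 : R.mu σ s = L := (R.tendsto_pairing hσ hs hσ1 hs1 hL').limUnder_eq
  refine ⟨R.eta_mem_visualBoundary hs hs1, R.eta_mem_visualBoundary hσ hσ1, ?_, ?_, h3.trans h2.symm⟩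
  · rw [h2]; exact h1
  · rw [h2]
    have h4 := cos_titsAngle_eq R.isNonpositivelyCurved hc hc' h0 hL h1
      (Eventually.of_forall fun t => R.exists_endpoint_cosComp_le hs hσ hs1 hσ1 t)
    rw [← R.eta_eq, ← R.eta_eq] at h4
    exact h4.symm

end RealReductiveGroup

end

theorem mainTheorem12 {E : Type*} [NormedAddCommGroup E] [NormedSpace ℝ E] [FiniteDimensional ℝ E]
    {G : Type*} [TopologicalSpace G] [T2Space G] [ChartedSpace E G] [Group G]
    [LieGroup 𝓘(ℝ, E) ∞ G] (R : RealReductiveGroup E G)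
    (s σ : GroupLieAlgebra 𝓘(ℝ, E) G) (hs : s ∈ R.m) (hσ : σ ∈ R.m)
    (hs1 : R.B s s = 1) (hσ1 : R.B σ σ = 1) :
    R.eta s ∈ MetricBoundary.visualBoundary R.SymSpace ∧
    R.eta σ ∈ MetricBoundary.visualBoundary R.SymSpace ∧
    Tendsto (fun t : ℝ => R.B (R.act s (lieExp (-(t • σ)))) σ) atTop (𝓝 (R.mu s σ)) ∧
    R.mu s σ = Real.cos (MetricBoundary.titsAngle (R.eta σ) (R.eta s)) ∧
    R.mu σ s = R.mu s σ := by
  have hm {X : E} (hX : X ∈ R.m) (hX1 : R.B X X = 1) : R.th X = -X ∧ R.nrm X = 1 := by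
    have h : R.th X = -X := hX
    refine ⟨h, ?_⟩
    rw [RealReductiveGroup.nrm, R.ip_eq_bil h, show R.bil X X = 1 from hX1, Real.sqrt_one]
  obtain ⟨hs, hs1⟩ := hm hs hs1
  obtain ⟨hσ, hσ1⟩ := hm hσ hσ1
  exact R.tendsto_pairing_and_mu_eq hs hσ hs1 hσ1
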